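/- All subgraphs are induced. Let $G$ be a graph. A vertex $x$ of a subgraph $A$ of $G$ is \emph{removable} from $A$ if $x$ has at most one neighbour in $A$, or exactly two neighbours in $A$ and these two form an edge. A subgraph $A$ of $G$ is \emph{strong} in $G$, written $A\le G$, if for every finite subgraph $B_0$ of $G$ not contained in $A$, the graph $B_0\cup A$ has a removable vertex $x\in (B_0\cup A)\setminus A$. A \emph{strong embedding} is an embedding onto a strong (induced) subgraph. Let $\mathcal K$ be the class of finite graphs in which every edge is contained in at most two triangles and every nonempty subgraph has a removable vertex. A graph $M$ is \emph{$\mathcal K$-saturated} if every finite subgraph of $M$ belongs to $\mathcal K$ and, for all $A,B\in\mathcal K$ with $A\le B$, every strong embedding of $A$ into $M$ extends to a strong embedding of $B$ into $M$. Let $T$ be the first-order theory of graphs, in the language with one binary relation symbol, stating that (0) every vertex has at least one neighbour; (1) every edge is contained in exactly two triangles; (2) every nonempty finite subgraph has a removable vertex. A structure $M$ is \emph{$\omega$-saturated} if for every finite set $A\subseteq M$, every set of formulas in one variable with parameters from $A$ that is finitely satisfiable in $M$ is realized in $M$. \textbf{Proposition.} Let $M$ be a (nonempty) model of $T$. Then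 $M$ is $\mathcal K$-saturated if and only if $M$ is $\omega$-saturated. -/

import Mathlib

namespace FareyModel

open FirstOrder FirstOrder.Language

/-! ### Removable vertices, strong subgraphs, the class K -/

/-- `x` is a removable vertex of the subgraph of `G` induced on `S`: it lies in `S`, and inside `S`
it has at most one neighbour, or exactly two neighbours, which form an edge. -/
def IsRemovable {V : Type*} (G : SimpleGraph V) (S : Set V) (x : V) : Prop :=
  x ∈ S ∧ ((G.neighborSet x ∩ S).encard ≤ 1 ∨
    ∃ y z : V, G.neighborSet x ∩ S = {y, z} ∧ G.Adj y z)

/-- The subgraph of `G` induced on `A` is strong in `G`: for every finite `B₀` that is not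
contained in `A`, the subgraph induced on `B₀ ∪ A` has a removable vertex outside `A`. -/
def IsStrong {V : Type*} (G : SimpleGraph V) (A : Set V) : Prop :=
  ∀ B₀ : Set V, B₀.Finite → ¬ B₀ ⊆ A → ∃ x ∈ (B₀ ∪ A) \ A, IsRemovable G (B₀ ∪ A) x

/-- The class `K`: finite graphs in which every edge lies in at most two triangles (the triangles
on an edge `xy` correspond to the common neighbours of `x` and `y`) and every nonempty induced
subgraph has a removable vertex. -/
def InK {V : Type*} (G : SimpleGraph V) : Prop :=
  Finite V ∧ (∀ x y : V, G.Adj x y → (G.commonNeighbors x y).encard ≤ 2) ∧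
    ∀ S : Set V, S.Nonempty → ∃ x, IsRemovable G S x

/-- `G` is `K`-saturated: all its finite induced subgraphs are in `K`, and whenever `H` is in `K`,
`A` is strong in `H` and `f` is a strong embedding of `A` into `G`, then `f` extends to a strong
embedding of `H` into `G`. -/
def IsKSaturated {V : Type*} (G : SimpleGraph V) : Prop :=
  (∀ S : Set V, S.Finite → InK (G.induce S)) ∧
    ∀ (B : Type) (H : SimpleGraph B) (A : Set B), InK H → InK (H.induce A) → IsStrong H A →
      ∀ f : H.induce A ↪g G, IsStrong G (Set.range f) →
        ∃ g : H ↪g G, IsStrong G (Set.range g) ∧ ∀ a : A, g a = f a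

/-! ### The first-order theory -/

/-- The formula `E(xᵢ, xⱼ)`. -/
def edge {n : ℕ} (i j : Fin n) : Language.graph.BoundedFormula Empty n :=
  adj.boundedFormula₂ (Term.var (Sum.inr i)) (Term.var (Sum.inr j))

/-- The formula `xᵢ = xⱼ`. -/
def same {n : ℕ} (i j : Fin n) : Language.graph.BoundedFormula Empty n :=
  (Term.var (Sum.inr i)).bdEqual (Term.var (Sum.inr j))

/-- The formula saying that `xᵢ` is a removable vertex of the subgraph induced on
`{x₀, …, xₙ₋₁}`. -/
noncomputable def removableFormula {n : ℕ} (i : Fin n) :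
    Language.graph.BoundedFormula Empty n :=
  (BoundedFormula.iSup fun j : Fin n => BoundedFormula.iInf fun k : Fin n =>
      (edge i k).imp (same k j)) ⊔
    BoundedFormula.iSup fun j : Fin n => BoundedFormula.iSup fun k : Fin n =>
      ((edge i j ⊓ edge i k) ⊓ edge j k) ⊓
        BoundedFormula.iInf fun l : Fin n => (edge i l).imp (same l j ⊔ same l k)

/-- Every subgraph with at least one and at most `n + 1` vertices has a removable vertex. -/
noncomputable def removableSentence (n : ℕ) : Language.graph.Sentence :=
  (BoundedFormula.iSup fun i : Fin (n + 1) => removableFormula i).alls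

/-- Every edge is contained in exactly two triangles. -/
def twoTrianglesSentence : Language.graph.Sentence :=
  ((edge (n := 2) 0 1).imp
    (((((∼(same (n := 4) 2 3) ⊓ (edge 0 2 ⊓ edge 1 2)) ⊓ (edge 0 3 ⊓ edge 1 3)) ⊓
      ((edge (n := 5) 0 4 ⊓ edge 1 4).imp (same 4 2 ⊔ same 4 3)).all).ex).ex)).all.all

/-- Every vertex has a neighbour. -/
def noIsolatedSentence : Language.graph.Sentence :=
  ((edge (n := 2) 0 1).ex).all

/-- The axioms `T`: graphs without isolated vertices in which every edge is contained in exactly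
two triangles and every nonempty finite subgraph has a removable vertex. -/
noncomputable def fareyTheory : Language.graph.Theory :=
  Theory.simpleGraph ∪ ({noIsolatedSentence, twoTrianglesSentence} ∪ Set.range removableSentence)

instance model_simpleGraph (M : Type*) [Language.graph.Structure M] [h : M ⊨ fareyTheory] :
    M ⊨ Theory.simpleGraph :=
  h.mono Set.subset_union_left

lemma realize_edge {V : Type*} [Language.graph.Structure V] {n : ℕ} (i j : Fin n) (v : Empty → V)
    (x : Fin n → V) : (edge i j).Realize v x ↔ Structure.RelMap adj ![x i, x j] := by
  simp [edge, BoundedFormula.realize_rel₂]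

lemma realize_same {V : Type*} [Language.graph.Structure V] {n : ℕ} (i j : Fin n) (v : Empty → V)
    (x : Fin n → V) : (same i j).Realize v x ↔ x i = x j := by
  simp [same]

/-- The models of `fareyTheory` among graphs, described without formulas. -/
theorem model_fareyTheory_iff {V : Type*} [Language.graph.Structure V] [V ⊨ Theory.simpleGraph] :
    V ⊨ fareyTheory ↔ (∀ x : V, ∃ y, (simpleGraphOfStructure V).Adj x y) ∧
      (∀ x y : V, (simpleGraphOfStructure V).Adj x y →
        ((simpleGraphOfStructure V).commonNeighbors x y).encard = 2) ∧
      ∀ S : Set V, S.Finite → S.Nonempty → ∃ x, IsRemovable (simpleGraphOfStructure V) S x := by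
  have h0 : V ⊨ noIsolatedSentence ↔ (∀ x : V, ∃ y, (simpleGraphOfStructure V).Adj x y) := by
    simp [noIsolatedSentence, Sentence.Realize, Formula.Realize, realize_edge, Fin.snoc]
  have h1 : V ⊨ twoTrianglesSentence ↔ (∀ x y : V, (simpleGraphOfStructure V).Adj x y →
        ((simpleGraphOfStructure V).commonNeighbors x y).encard = 2) := by
    simp only [twoTrianglesSentence, Sentence.Realize, Formula.Realize, BoundedFormula.realize_all,
      BoundedFormula.realize_imp, BoundedFormula.realize_ex, BoundedFormula.realize_inf,
      BoundedFormula.realize_sup, BoundedFormula.realize_not, realize_edge, realize_same]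
    refine forall_congr' fun x => forall_congr' fun y => imp_congr ?_ ?_
    · simp [Fin.snoc]
    · rw [Set.encard_eq_two]
      refine exists_congr fun z => exists_congr fun w => ?_
      simp only [Set.ext_iff, SimpleGraph.mem_commonNeighbors]
      simp [Fin.snoc]
      grind
  have h2 : (∀ n, V ⊨ removableSentence n) ↔ ∀ S : Set V, S.Finite → S.Nonempty →
      ∃ x, IsRemovable (simpleGraphOfStructure V) S x := by
    have key : ∀ n, V ⊨ removableSentence n ↔ ∀ f : Fin (n+1) → V,
        ∃ i, IsRemovable (simpleGraphOfStructure V) (Set.range f) (f i) := by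
      intro n
      simp only [removableSentence, removableFormula, Sentence.Realize,
        BoundedFormula.realize_alls, BoundedFormula.realize_iSup, BoundedFormula.realize_iInf,
        BoundedFormula.realize_imp, BoundedFormula.realize_inf,
        BoundedFormula.realize_sup, realize_edge, realize_same]
      refine forall_congr' fun f => exists_congr fun i => ?_
      simp only [IsRemovable, Set.mem_range_self, true_and]
      refine or_congr ?_ ?_
      · rw [Set.encard_le_one_iff]
        simp only [Set.mem_inter_iff, SimpleGraph.mem_neighborSet, simpleGraphOfStructure_adj,
          Set.mem_range]
        constructor
        · rintro ⟨j, hj⟩ _ _ ⟨h1, a, rfl⟩ ⟨h2, b, rfl⟩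
          exact (hj _ h1).trans (hj _ h2).symm
        · intro h
          by_cases hk : ∃ k, Structure.RelMap adj ![f i, f k]
          · obtain ⟨k, hk⟩ := hk
            exact ⟨k, fun l hl => h _ _ ⟨hl, l, rfl⟩ ⟨hk, k, rfl⟩⟩
          · exact ⟨i, fun l hl => (hk ⟨l, hl⟩).elim⟩
      · simp only [Set.ext_iff, Set.mem_inter_iff, SimpleGraph.mem_neighborSet,
          simpleGraphOfStructure_adj, Set.mem_range, Set.mem_insert_iff, Set.mem_singleton_iff]
        constructor
        · rintro ⟨j, k, ⟨⟨h1, h2⟩, h3⟩, h4⟩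
          refine ⟨f j, f k, fun x => ⟨?_, ?_⟩, h3⟩
          · rintro ⟨h, l, rfl⟩
            exact h4 l h
          · rintro (rfl | rfl)
            exacts [⟨h1, _, rfl⟩, ⟨h2, _, rfl⟩]
        · rintro ⟨y, z, h, h3⟩
          obtain ⟨h1, j, rfl⟩ := (h y).2 (Or.inl rfl)
          obtain ⟨h2, k, rfl⟩ := (h z).2 (Or.inr rfl)
          exact ⟨j, k, ⟨⟨h1, h2⟩, h3⟩, fun l hl => (h _).1 ⟨hl, l, rfl⟩⟩
    simp only [key]
    constructor
    · intro h S hS hne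
      have : Finite S := hS
      have : Nonempty S := hne.to_subtype
      obtain ⟨n, ⟨e⟩⟩ := Finite.exists_equiv_fin S
      obtain _ | n := n
      · exact (e (Classical.arbitrary S)).elim0
      have hr : Set.range (fun i => (e.symm i : V)) = S := by
        ext x
        exact ⟨by rintro ⟨i, rfl⟩; exact (e.symm i).2, fun hx => ⟨e ⟨x, hx⟩, by simp⟩⟩
      obtain ⟨i, hi⟩ := h n fun i => e.symm i
      exact ⟨_, hr ▸ hi⟩
    · intro h n f
      obtain ⟨x, hx⟩ := h _ (Set.finite_range f) (Set.range_nonempty f)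
      obtain ⟨i, rfl⟩ := hx.1
      exact ⟨i, hx⟩
  rw [← h0, ← h1, ← h2]
  have hs : V ⊨ Theory.simpleGraph := inferInstance
  rw [fareyTheory, Theory.model_union_iff, Theory.model_union_iff, Theory.model_insert_iff,
    Theory.model_singleton_iff]
  simp only [hs, true_and, and_assoc, Theory.model_iff (Set.range _), Set.forall_mem_range]

/-! ### Saturation -/

/-- `M` is `ω`-saturated: every set of formulas in one variable with parameters from a finite
subset `A` of `M` that is finitely satisfiable in `M` is realized in `M`. In a formula over
`A ⊕ Unit`, the variables in `A` are evaluated at the parameters, the remaining one is the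
variable of the type. -/
def IsOmegaSaturated (L : Language) (M : Type*) [L.Structure M] : Prop :=
  ∀ A : Set M, A.Finite → ∀ p : Set (L.Formula (A ⊕ Unit)),
    (∀ q ⊆ p, q.Finite →
      ∃ b : M, ∀ φ ∈ q, φ.Realize (Sum.elim (fun a : A => (a : M)) fun _ => b)) →
    ∃ b : M, ∀ φ ∈ p, φ.Realize (Sum.elim (fun a : A => (a : M)) fun _ => b)

end FareyModel

namespace FareyModel

open FirstOrder FirstOrder.Language

/-! ### Graphs of models -/

/-! Being strong is the conjunction over `n` of being `n`-strong (`isStrong_iff_isNStrong`), and for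
a finite tuple each `n`-strongness is a first-order condition. So ω-saturation yields a one-vertex
strong extension as soon as `n`-strong approximations exist for every `n`.

From ω-saturation to `K`-saturation, a strong extension is built one vertex at a time, and each new
vertex has at most one neighbour in the strong set already built, or two adjacent ones. With two
adjacent neighbours, the axiom on triangles supplies the vertex and strongness is automatic
(`IsStrong.insert_of_adj_of_adj`). With one neighbour `a`, the link of `a` is infinite and
2-regular, so it contains vertices far from `A`, and these are `n`-strong approximations. With no
neighbour, the approximations are vertices far from `A` in the whole graph. They exist because
pendant vertices can be attached repeatedly and no detour through a finite extension of a strong set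
shortens distances (`IsStrong.exists_lipschitz_extension`).

From `K`-saturation to ω-saturation, pass to an ultrapower `N` of `M` over a nonprincipal
ultrafilter on `ℕ`. It is an ω-saturated model of `T`, hence `K`-saturated by the first direction.
Finite subsets of models lie in finite strong sets, so partial isomorphisms between finite strong
sets form a back-and-forth system between `N` and `M` and preserve all formulas
(`StronglyIsomorphic.realize_boundedFormula_iff`). A realization of the type in `N` is thereby
carried back to `M`. -/

/-- The graphs underlying the models of `fareyTheory`. -/
structure IsFareyGraph {V : Type*} (G : SimpleGraph V) : Prop where
  exists_adj : ∀ x, ∃ y, G.Adj x y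
  encard_commonNeighbors : ∀ x y, G.Adj x y → (G.commonNeighbors x y).encard = 2
  exists_isRemovable : ∀ S : Set V, S.Finite → S.Nonempty → ∃ x, IsRemovable G S x

/-- `A` is strong with respect to extensions by at most `n` vertices. -/
def IsNStrong {V : Type*} (G : SimpleGraph V) (n : ℕ) (A : Set V) : Prop :=
  ∀ C, A ⊆ C → (C \ A).Nonempty → (C \ A).encard ≤ n → ∃ x ∈ C \ A, IsRemovable G C x

section Graph

variable {V : Type*} {G : SimpleGraph V} {A C S : Set V} {a b x y : V} {m n : ℕ}

lemma IsNStrong.anti (h : IsNStrong G n A) (hmn : m ≤ n) : IsNStrong G m A :=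
  fun C hC hne hc => h C hC hne (hc.trans (by exact_mod_cast hmn))

lemma isStrong_iff : IsStrong G A ↔
    ∀ C, A ⊆ C → (C \ A).Nonempty → (C \ A).Finite → ∃ x ∈ C \ A, IsRemovable G C x := by
  constructor
  · intro h C hC hne hfin
    have := h (C \ A) hfin (fun h' => by obtain ⟨x, hx⟩ := hne; exact hx.2 (h' hx))
    rwa [Set.sdiff_union_of_subset hC] at this
  · intro h B hB hBA
    refine h _ Set.subset_union_right ?_ (hB.subset (by grind))
    obtain ⟨x, hx, hxA⟩ := Set.not_subset.1 hBA
    exact ⟨x, Or.inl hx, hxA⟩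

lemma isStrong_iff_isNStrong : IsStrong G A ↔ ∀ n, IsNStrong G n A := by
  rw [isStrong_iff]
  constructor
  · intro h n C hC hne hc
    exact h C hC hne (Set.finite_of_encard_le_coe hc)
  · intro h C hC hne hfin
    exact h _ C hC hne hfin.cast_ncard_eq.symm.le

lemma IsStrong.exists_isRemovable (h : IsStrong G A) (hC : A ⊆ C) (hne : (C \ A).Nonempty)
    (hfin : (C \ A).Finite) : ∃ x ∈ C \ A, IsRemovable G C x :=
  isStrong_iff.1 h C hC hne hfin

lemma IsRemovable.congr (h : IsRemovable G S x) (hx : x ∈ C)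
    (hC : G.neighborSet x ∩ C = G.neighborSet x ∩ S) : IsRemovable G C x := by
  refine ⟨hx, ?_⟩
  rw [hC]
  exact h.2

lemma IsRemovable.of_erase (h : IsRemovable G (C \ {x}) y) (hxy : ¬ G.Adj y x) :
    IsRemovable G C y := by
  refine h.congr h.1.1 ?_
  ext z
  simp only [Set.mem_inter_iff, SimpleGraph.mem_neighborSet, Set.mem_sdiff, Set.mem_singleton_iff]
  grind

lemma IsRemovable.cases (h : IsRemovable G S x) : G.neighborSet x ∩ S = ∅ ∨
    (∃ a, G.neighborSet x ∩ S = {a}) ∨ ∃ a b, G.neighborSet x ∩ S = {a, b} ∧ G.Adj a b := by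
  obtain ⟨-, h | h⟩ := h
  · rw [Set.encard_le_one_iff_eq] at h
    grind
  · grind

lemma isRemovable_of_eq_singleton (hx : x ∈ S) (h : G.neighborSet x ∩ S = {a}) :
    IsRemovable G S x :=
  ⟨hx, Or.inl (by simp [h])⟩

lemma isRemovable_of_eq_pair (hx : x ∈ S) (h : G.neighborSet x ∩ S = {a, b}) (hab : G.Adj a b) :
    IsRemovable G S x :=
  ⟨hx, Or.inr ⟨a, b, h, hab⟩⟩

lemma IsRemovable.of_mem (h : IsRemovable G S x) (ha : a ∈ S) (hxa : G.Adj x a) :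
    G.neighborSet x ∩ S = {a} ∨ ∃ b, G.neighborSet x ∩ S = {a, b} ∧ G.Adj a b := by
  have : a ∈ G.neighborSet x ∩ S := ⟨hxa, ha⟩
  rcases h.cases with h | ⟨c, h⟩ | ⟨c, d, h, hcd⟩
  · simp [h] at this
  · left
    rw [h] at this ⊢
    rw [Set.mem_singleton_iff.1 this]
  · right
    rw [h] at this ⊢
    rcases this with rfl | rfl
    · exact ⟨d, rfl, hcd⟩
    · exact ⟨c, Set.pair_comm _ _, hcd.symm⟩

lemma IsRemovable.of_mem_of_mem (h : IsRemovable G S x) (ha : a ∈ S) (hxa : G.Adj x a)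
    (hb : b ∈ S) (hxb : G.Adj x b) (hab : a ≠ b) :
    G.neighborSet x ∩ S = {a, b} ∧ G.Adj a b := by
  have hbm : b ∈ G.neighborSet x ∩ S := ⟨hxb, hb⟩
  rcases h.of_mem ha hxa with h | ⟨c, h, hac⟩
  · rw [h] at hbm
    exact (hab (Set.mem_singleton_iff.1 hbm).symm).elim
  · rw [h] at hbm
    rcases hbm with rfl | rfl
    · exact (hab rfl).elim
    · exact ⟨h, hac⟩

/-- The neighbours in a strong set of a vertex outside of it. -/
lemma IsStrong.isRemovable_insert (hA : IsStrong G A) (hx : x ∉ A) :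
    IsRemovable G (insert x A) x := by
  have : insert x A \ A = {x} := by grind
  obtain ⟨y, hy, h⟩ := hA.exists_isRemovable (Set.subset_insert x A) (by simp [this])
    (by simp [this])
  rw [this] at hy
  exact Set.mem_singleton_iff.1 hy ▸ h

lemma IsStrong.neighborSet_inter_eq_pair (hA : IsStrong G A) (hx : x ∉ A) (ha : a ∈ A)
    (hxa : G.Adj x a) (hb : b ∈ A) (hxb : G.Adj x b) (hab : a ≠ b) :
    G.neighborSet x ∩ A = {a, b} ∧ G.Adj a b := by
  have := (hA.isRemovable_insert hx).of_mem_of_mem (Or.inr ha) hxa (Or.inr hb) hxb hab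
  rwa [Set.inter_insert_of_notMem (by simp)] at this

/-- Apply strongness of `A` to `C \ {x}`: the vertex found lies outside `A`, so it is not adjacent
to `x`, and putting `x` back does not change its neighbourhood. -/
lemma IsStrong.exists_isRemovable_of_subset (hA : IsStrong G A) (hx : x ∉ A)
    (hC : insert x A ⊆ C) (hne : (C \ insert x A).Nonempty) (hfin : (C \ A).Finite)
    (hN : G.neighborSet x ∩ C ⊆ A) : ∃ y ∈ C \ insert x A, IsRemovable G C y := by
  obtain ⟨y, hy, h⟩ := hA.exists_isRemovable (C := C \ {x}) (by grind)
    (hne.mono (by grind)) (hfin.subset (by grind))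
  refine ⟨y, by grind, h.of_erase fun hyx => ?_⟩
  exact hy.2 (hN ⟨hyx.symm, hy.1.1⟩)

lemma IsStrong.exists_isRemovable_or (hA : IsStrong G A) (hx : x ∉ A)
    (hC : insert x A ⊆ C) (hfin : (C \ A).Finite) :
    (∃ y ∈ C \ insert x A, IsRemovable G C y) ∨ IsRemovable G C x := by
  obtain ⟨y, hy, h⟩ := hA.exists_isRemovable (C := C) (by grind)
    ⟨x, by grind⟩ hfin
  by_cases hyx : y = x
  · exact Or.inr (hyx ▸ h)
  · exact Or.inl ⟨y, by grind, h⟩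

/-- Adding a vertex that forms a triangle with an edge of a strong set. -/
lemma IsStrong.insert_of_adj_of_adj (hA : IsStrong G A) (hx : x ∉ A) (ha : a ∈ A)
    (hxa : G.Adj x a) (hb : b ∈ A) (hxb : G.Adj x b) (hab : a ≠ b) :
    IsStrong G (insert x A) := by
  rw [isStrong_iff]
  intro C hC hne hfin
  have hfin' : (C \ A).Finite := (hfin.insert x).subset (by grind)
  refine (hA.exists_isRemovable_or hx hC hfin').elim id fun h => ?_
  -- If `x` itself is the removable vertex, then `a` and `b` already exhaust its neighbours in `C`.
  refine hA.exists_isRemovable_of_subset hx hC hne hfin' ?_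
  rw [(h.of_mem_of_mem (hC (Or.inr ha)) hxa (hC (Or.inr hb)) hxb hab).1]
  grind

lemma encard_diff_erase_le (hx : x ∈ C \ A) (h : (C \ A).encard ≤ (n + 1 : ℕ)) :
    ((C \ {x}) \ A).encard ≤ n := by
  have := Set.encard_sdiff_singleton_add_one hx
  rw [show (C \ A) \ {x} = (C \ {x}) \ A by grind] at this
  rw [← this] at h
  exact_mod_cast (WithTop.add_le_add_iff_right WithTop.one_ne_top).1 (by exact_mod_cast h)

/-! ### Balls in the link of a vertex -/

/-- The ball of radius `n` around `A` in the link of `a`. -/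
def linkBall {V : Type*} (G : SimpleGraph V) (A : Set V) (a : V) : ℕ → Set V
  | 0 => A ∩ G.neighborSet a
  | n + 1 => linkBall G A a n ∪ ⋃ y ∈ linkBall G A a n, G.commonNeighbors a y

lemma linkBall_mono (hmn : m ≤ n) : linkBall G A a m ⊆ linkBall G A a n :=
  monotone_nat_of_le_succ (f := linkBall G A a) (fun _ => Set.subset_union_left) hmn

lemma mem_linkBall_succ (hay : G.Adj a x) (hyx : G.Adj y x) (hy : y ∈ linkBall G A a n) :
    x ∈ linkBall G A a (n + 1) :=
  Or.inr (Set.mem_biUnion hy ⟨hay, hyx⟩)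

lemma mem_linkBall_of_mem (hx : x ∈ A) (hax : G.Adj a x) : x ∈ linkBall G A a n :=
  linkBall_mono (Nat.zero_le n) ⟨hx, hax⟩

lemma adj_of_mem_linkBall (h : x ∈ linkBall G A a n) : G.Adj a x := by
  induction n generalizing x with
  | zero => exact h.2
  | succ n ih =>
    rcases h with h | h
    · exact ih h
    · simp only [Set.mem_iUnion] at h
      obtain ⟨y, -, h⟩ := h
      exact h.1

lemma IsFareyGraph.finite_linkBall (hG : IsFareyGraph G) (hA : A.Finite) (n : ℕ) :
    (linkBall G A a n).Finite := by
  induction n with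
  | zero => exact hA.inter_of_left _
  | succ n ih =>
    refine ih.union (ih.biUnion fun y hy => ?_)
    refine Set.finite_of_encard_eq_coe (k := 2) ?_
    exact hG.encard_commonNeighbors a y (adj_of_mem_linkBall hy)

/-- The closed neighbourhood of `a` has no removable vertex: each vertex in it lies on an edge at
`a`, and both triangles on that edge stay inside, which gives three distinct neighbours. By the
third axiom it cannot be finite. -/
lemma IsFareyGraph.infinite_neighborSet (hG : IsFareyGraph G) (a : V) :
    (G.neighborSet a).Infinite := by
  intro hfin
  obtain ⟨x, hx⟩ := hG.exists_isRemovable _ (hfin.insert a) (Set.insert_nonempty _ _)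
  have key : ∀ u v z w, G.Adj u v → z ≠ w → G.Adj u z → G.Adj v z → G.Adj u w → G.Adj v w →
      IsRemovable G (insert a (G.neighborSet a)) u → v ∈ insert a (G.neighborSet a) →
      z ∈ insert a (G.neighborSet a) → w ∈ insert a (G.neighborSet a) → False := by
    intro u v z w huv hzw huz hvz huw hvw h hv hz hw
    have h1 := (h.of_mem_of_mem hv huv hz huz hvz.ne).1
    have h2 : w ∈ G.neighborSet u ∩ insert a (G.neighborSet a) := ⟨huw, hw⟩
    rw [h1] at h2
    rcases h2 with rfl | rfl
    · exact hvw.ne rfl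
    · exact hzw rfl
  rcases hx.1 with rfl | hax
  · obtain ⟨y, hy⟩ := hG.exists_adj x
    obtain ⟨z, w, hzw, h⟩ := Set.encard_eq_two.1 (hG.encard_commonNeighbors x y hy)
    have hz : z ∈ G.commonNeighbors x y := by simp [h]
    have hw : w ∈ G.commonNeighbors x y := by simp [h]
    exact key x y z w hy hzw hz.1 hz.2 hw.1 hw.2 hx (Or.inr hy) (Or.inr hz.1) (Or.inr hw.1)
  · have hax : G.Adj a x := hax
    obtain ⟨z, w, hzw, h⟩ := Set.encard_eq_two.1 (hG.encard_commonNeighbors a x hax)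
    have hz : z ∈ G.commonNeighbors a x := by simp [h]
    have hw : w ∈ G.commonNeighbors a x := by simp [h]
    exact key x a z w hax.symm hzw hz.2 hz.1 hw.2 hw.1 hx (Or.inl rfl) (Or.inr hz.1) (Or.inr hw.1)

/-- A second neighbour of `x` in `A` would be adjacent to `a` by strongness, placing `x` within
distance one of `A` in the link of `a`. -/
lemma IsStrong.neighborSet_inter_of_notMem_linkBall (hA : IsStrong G A) (ha : a ∈ A)
    (hax : G.Adj a x) (hx : x ∉ linkBall G A a 1) : x ∉ A ∧ G.neighborSet x ∩ A = {a} := by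
  have hxA : x ∉ A := fun h => hx (mem_linkBall_of_mem h hax)
  refine ⟨hxA, Set.eq_singleton_iff_unique_mem.2 ⟨⟨hax.symm, ha⟩, fun z hz => ?_⟩⟩
  by_contra hne
  have := (hA.neighborSet_inter_eq_pair hxA hz.2 hz.1 ha hax.symm hne).2
  exact hx (mem_linkBall_succ hax hz.1.symm ⟨hz.2, this.symm⟩)

/-- Adding a neighbour of `a` that is far from `A` in the link of `a`. -/
lemma IsStrong.exists_isRemovable_of_notMem_linkBall (hA : IsStrong G A) (ha : a ∈ A)
    (hax : G.Adj a x) (hx : x ∉ linkBall G A a (n + 1)) (hC : insert x A ⊆ C)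
    (hne : (C \ insert x A).Nonempty) (hcard : (C \ A).encard ≤ (n + 1 : ℕ)) :
    ∃ y ∈ C \ insert x A, IsRemovable G C y := by
  induction n generalizing x C with
  | zero =>
    obtain ⟨y, hy⟩ := hne
    have hxA := (hA.neighborSet_inter_of_notMem_linkBall ha hax hx).1
    have := (Set.encard_le_one_iff (s := C \ A)).1 (by simpa using hcard) x y ⟨hC (Or.inl rfl), hxA⟩
      ⟨hy.1, fun h => hy.2 (Or.inr h)⟩
    exact (hy.2 (Or.inl this.symm)).elim
  | succ n ih =>
    have hxA := (hA.neighborSet_inter_of_notMem_linkBall ha hax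
      (fun h => hx (linkBall_mono (by omega) h))).1
    have hfin : (C \ A).Finite := Set.finite_of_encard_le_coe hcard
    refine (hA.exists_isRemovable_or hxA hC hfin).elim id fun h => ?_
    -- If `x` is the removable vertex, its neighbours in `C` are `a` and possibly one `y` adjacent
    -- to `a`. This `y` lies in the link of `a` and is at most one step closer to `A`, so the
    -- induction applies to `y` in `C \ {x}`. If only `y` is left there, `y` is removable itself,
    -- its neighbours being `x` and `a`.
    rcases h.of_mem (hC (Or.inr ha)) hax.symm with h | ⟨y, h, hay⟩
    · exact hA.exists_isRemovable_of_subset hxA hC hne hfin (by rw [h]; simpa using ha)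
    have hy : y ∈ G.neighborSet x ∩ C := by simp [h]
    have hyn : y ∉ linkBall G A a (n + 1) := fun h' => hx (mem_linkBall_succ hax hy.1.symm h')
    obtain ⟨hyA, hNy⟩ := hA.neighborSet_inter_of_notMem_linkBall ha hay
      (fun h => hyn (linkBall_mono (by omega) h))
    have hxy : G.Adj x y := hy.1
    by_cases hne' : ((C \ {x}) \ insert y A).Nonempty
    · obtain ⟨z, hz, hzr⟩ := ih hay hyn (C := C \ {x}) (by grind [hxy.ne]) hne'
        (encard_diff_erase_le ⟨hC (Or.inl rfl), hxA⟩ hcard)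
      refine ⟨z, by grind, hzr.of_erase fun hzx => ?_⟩
      have : z ∈ G.neighborSet x ∩ C := ⟨hzx.symm, hz.1.1⟩
      rw [h] at this
      rcases this with rfl | rfl
      · exact hz.2 (Or.inr ha)
      · exact hz.2 (Or.inl rfl)
    · have hC' : C = insert x (insert y A) := by
        rw [Set.not_nonempty_iff_eq_empty, Set.sdiff_eq_empty] at hne'
        grind
      refine ⟨y, ⟨hy.2, by grind [hxy.ne]⟩, ?_⟩
      refine isRemovable_of_eq_pair (a := x) (b := a) hy.2 ?_ hax.symm
      rw [hC', Set.inter_insert_of_mem (by simpa using hxy.symm),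
        Set.inter_insert_of_notMem (by simp), hNy]

lemma IsStrong.isNStrong_insert_of_notMem_linkBall (hA : IsStrong G A) (ha : a ∈ A)
    (hax : G.Adj a x) (hx : x ∉ linkBall G A a (n + 1)) : IsNStrong G n (insert x A) := by
  intro C hC hne hcard
  refine hA.exists_isRemovable_of_notMem_linkBall ha hax hx hC hne ?_
  calc (C \ A).encard ≤ (insert x (C \ insert x A)).encard := Set.encard_le_encard (by grind)
    _ ≤ (C \ insert x A).encard + 1 := Set.encard_insert_le _ _
    _ ≤ (n + 1 : ℕ) := by push_cast; gcongr

/-- Approximations of a strong extension by a pendant vertex. -/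
lemma IsFareyGraph.exists_isNStrong_pendant (hG : IsFareyGraph G) (hA : IsStrong G A)
    (hfin : A.Finite) (ha : a ∈ A) (n : ℕ) :
    ∃ x, x ∉ A ∧ G.neighborSet x ∩ A = {a} ∧ IsNStrong G n (insert x A) := by
  obtain ⟨x, hax, hx⟩ := (hG.infinite_neighborSet a).exists_notMem_finite
    (hG.finite_linkBall (a := a) hfin (n + 1))
  obtain ⟨h1, h2⟩ := hA.neighborSet_inter_of_notMem_linkBall ha hax
    (fun h => hx (linkBall_mono (by omega) h))
  exact ⟨x, h1, h2, hA.isNStrong_insert_of_notMem_linkBall ha hax hx⟩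

/-- Along a path in the link of `a`, each new vertex forms a triangle with `a` and its predecessor,
so adding it preserves strongness. -/
lemma IsStrong.exists_isStrong_of_mem_linkBall (hA : IsStrong G A) (hfin : A.Finite) (ha : a ∈ A)
    (hx : x ∈ linkBall G A a n) : ∃ B, A ⊆ B ∧ x ∈ B ∧ B.Finite ∧ IsStrong G B := by
  induction n generalizing x with
  | zero => exact ⟨A, subset_rfl, hx.1, hfin, hA⟩
  | succ n ih =>
    rcases hx with hx | hx
    · exact ih hx
    · simp only [Set.mem_iUnion] at hx
      obtain ⟨y, hy, hax, hyx⟩ := hx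
      obtain ⟨B, hAB, hyB, hBfin, hB⟩ := ih hy
      by_cases hxB : x ∈ B
      · exact ⟨B, hAB, hxB, hBfin, hB⟩
      · exact ⟨insert x B, hAB.trans (Set.subset_insert _ _), Set.mem_insert _ _, hBfin.insert x,
          hB.insert_of_adj_of_adj hxB (hAB ha) hax.symm hyB hyx.symm
            (adj_of_mem_linkBall hy).ne⟩

/-- Either `x` is reached from `A` inside the link of `a`, or it lies outside all link balls and
`insert x A` is `n`-strong for every `n`. -/
lemma IsStrong.exists_isStrong_of_adj (hA : IsStrong G A) (hfin : A.Finite) (ha : a ∈ A)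
    (hax : G.Adj a x) : ∃ B, A ⊆ B ∧ x ∈ B ∧ B.Finite ∧ IsStrong G B := by
  by_cases h : ∃ n, x ∈ linkBall G A a n
  · obtain ⟨n, h⟩ := h
    exact hA.exists_isStrong_of_mem_linkBall hfin ha h
  · push Not at h
    exact ⟨insert x A, Set.subset_insert _ _, Set.mem_insert _ _, hfin.insert x,
      isStrong_iff_isNStrong.2 fun n => hA.isNStrong_insert_of_notMem_linkBall ha hax (h _)⟩

/-! ### Balls -/

/-- The ball of radius `n` around `A`. -/
def ball {V : Type*} (G : SimpleGraph V) (A : Set V) : ℕ → Set V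
  | 0 => A
  | n + 1 => ball G A n ∪ {x | ∃ y ∈ ball G A n, G.Adj y x}

lemma ball_mono (hmn : m ≤ n) : ball G A m ⊆ ball G A n :=
  monotone_nat_of_le_succ (f := ball G A) (fun _ => Set.subset_union_left) hmn

lemma mem_ball_succ (hy : y ∈ ball G A n) (hyx : G.Adj y x) : x ∈ ball G A (n + 1) :=
  Or.inr ⟨y, hy, hyx⟩

lemma neighborSet_inter_of_notMem_ball (hx : x ∉ ball G A 1) :
    x ∉ A ∧ G.neighborSet x ∩ A = ∅ := by
  refine ⟨fun h => hx (Or.inl h), Set.eq_empty_of_forall_notMem fun z hz => ?_⟩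
  exact hx (mem_ball_succ (n := 0) hz.2 hz.1.symm)

/-- Adding a clique with one or two vertices that is far from `A`. -/
lemma IsStrong.exists_isRemovable_of_notMem_ball (hA : IsStrong G A)
    (hx : x ∉ ball G A (n + 1)) (hy : y ∉ ball G A (n + 1)) (hxy : x ≠ y → G.Adj x y)
    (hC : insert x (insert y A) ⊆ C) (hne : (C \ insert x (insert y A)).Nonempty)
    (hcard : (C \ A).encard ≤ (n + 1 : ℕ)) :
    ∃ z ∈ C \ insert x (insert y A), IsRemovable G C z := by
  induction n generalizing x y C with
  | zero =>
    obtain ⟨z, hz⟩ := hne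
    have hxA := (neighborSet_inter_of_notMem_ball hx).1
    have := (Set.encard_le_one_iff (s := C \ A)).1 (by simpa using hcard) x z ⟨hC (Or.inl rfl), hxA⟩
      ⟨hz.1, fun h => hz.2 (Or.inr (Or.inr h))⟩
    exact (hz.2 (Or.inl this.symm)).elim
  | succ n ih =>
    have hxA := (neighborSet_inter_of_notMem_ball (fun h => hx (ball_mono (by omega) h))).1
    have hyA := (neighborSet_inter_of_notMem_ball (fun h => hy (ball_mono (by omega) h))).1
    have hxn : x ∉ ball G A (n + 1) := fun h => hx (ball_mono (by omega) h)
    have hyn : y ∉ ball G A (n + 1) := fun h => hy (ball_mono (by omega) h)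
    have hfin : (C \ A).Finite := Set.finite_of_encard_le_coe hcard
    obtain ⟨c, hc, hcr⟩ := hA.exists_isRemovable (C := C) (by grind) ⟨x, by grind⟩ hfin
    -- Only a removable vertex in the clique is a problem, and by symmetry it may be taken to be
    -- `x`. Its neighbours in `C` again form a clique, at most one step closer to `A`; delete `x`
    -- and use the induction hypothesis for that clique. The case `x = y` is allowed so that cliques
    -- of one vertex are covered.
    by_cases hcxy : c = x ∨ c = y
    swap
    · exact ⟨c, by grind, hcr⟩
    wlog hcx : c = x generalizing x y
    · rw [Set.insert_comm] at hC hne ⊢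
      exact this hy hx (fun h => (hxy h.symm).symm) hC hne hyA hxA hyn hxn hcxy.symm
        (hcxy.resolve_left hcx)
    subst hcx
    clear hcxy
    have hcardc := encard_diff_erase_le hc hcard
    -- the vertices `u`, `v` are the neighbours of `c` in `C`
    have key : ∀ u v, u ∉ ball G A (n + 1) → v ∉ ball G A (n + 1) → (u ≠ v → G.Adj u v) →
        G.neighborSet c ∩ C = {u, v} → y = c ∨ y = u ∨ y = v →
        ∃ z ∈ C \ insert c (insert y A), IsRemovable G C z := by
      intro u v hu hv huv hN hyuv
      have hu' : u ∈ G.neighborSet c ∩ C := by simp [hN]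
      have hv' : v ∈ G.neighborSet c ∩ C := by simp [hN]
      have hcu : G.Adj c u := hu'.1
      have hcv : G.Adj c v := hv'.1
      -- A vertex outside `{u, v}` is not adjacent to `c`, and it also differs from `y`, since `y`
      -- is one of `c`, `u`, `v`.
      by_cases hne' : ((C \ {c}) \ insert u (insert v A)).Nonempty
      · obtain ⟨z, hz, hzr⟩ := ih hu hv huv (C := C \ {c}) (by grind [hcu.ne, hcv.ne]) hne' hcardc
        refine ⟨z, by grind, hzr.of_erase fun hzx => ?_⟩
        have : z ∈ G.neighborSet c ∩ C := ⟨hzx.symm, hz.1.1⟩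
        rw [hN] at this
        grind
      · have hC' : C = insert c (insert u (insert v A)) := by
          rw [Set.not_nonempty_iff_eq_empty, Set.sdiff_eq_empty] at hne'
          grind
        obtain ⟨z, hz⟩ := hne
        -- one of `u`, `v` is removable
        have hzuv : z = u ∨ z = v := by grind
        have fin : ∀ s t, s ∉ ball G A (n + 1) → (s ≠ t → G.Adj s t) → G.Adj c s → G.Adj c t →
            s ∈ C → C = insert c (insert s (insert t A)) → IsRemovable G C s := by
          intro s t hs hst hcs hct hsC hC'
          have hsA := (neighborSet_inter_of_notMem_ball (fun h => hs (ball_mono (by omega) h))).2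
          by_cases hst' : s = t
          · subst hst'
            refine isRemovable_of_eq_singleton (a := c) hsC ?_
            rw [hC', Set.inter_insert_of_mem (by simpa using hcs.symm),
              Set.inter_insert_of_notMem (by simp), Set.inter_insert_of_notMem (by simp), hsA]
            simp
          · refine isRemovable_of_eq_pair (a := c) (b := t) hsC ?_ hct
            rw [hC', Set.inter_insert_of_mem (by simpa using hcs.symm),
              Set.inter_insert_of_notMem (by simp),
              Set.inter_insert_of_mem (by simpa using hst hst'), hsA]
            simp
        rcases hzuv with rfl | rfl
        · exact ⟨z, hz, fin z v hu huv hcu hcv hu'.2 hC'⟩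
        · exact ⟨z, hz, fin z u hv (fun h => (huv h.symm).symm) hcv hcu hv'.2
            (by rw [hC', Set.insert_comm u z])⟩
    have hnb : ∀ w, G.Adj c w → w ∉ ball G A (n + 1) :=
      fun w hw h => hx (mem_ball_succ h hw.symm)
    by_cases hcy : c = y
    · rcases hcr.cases with h | ⟨w, h⟩ | ⟨u, v, h, huv⟩
      · subst hcy
        rw [Set.insert_idem] at hC hne ⊢
        exact hA.exists_isRemovable_of_subset hxA hC hne hfin (by simp [h])
      · have hw : w ∈ G.neighborSet c ∩ C := by simp [h]
        exact key w w (hnb w hw.1) (hnb w hw.1) (by simp) (by simp [h]) (Or.inl hcy.symm)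
      · have hu : u ∈ G.neighborSet c ∩ C := by simp [h]
        have hv : v ∈ G.neighborSet c ∩ C := by simp [h]
        exact key u v (hnb u hu.1) (hnb v hv.1) (fun _ => huv) h (Or.inl hcy.symm)
    · rcases hcr.of_mem (hC (Or.inr (Or.inl rfl))) (hxy hcy) with h | ⟨w, h, hyw⟩
      · exact key y y hyn hyn (by simp) (by simp [h]) (by simp)
      · have hw : w ∈ G.neighborSet c ∩ C := by simp [h]
        exact key y w hyn (hnb w hw.1) (fun _ => hyw) h (by simp)

lemma IsStrong.isNStrong_insert_of_notMem_ball (hA : IsStrong G A)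
    (hx : x ∉ ball G A (n + 1)) : IsNStrong G n (insert x A) := by
  intro C hC hne hcard
  have := hA.exists_isRemovable_of_notMem_ball (C := C) hx hx (by simp)
  rw [Set.insert_idem] at this
  refine this hC hne ?_
  calc (C \ A).encard ≤ (insert x (C \ insert x A)).encard := Set.encard_le_encard (by grind)
    _ ≤ (C \ insert x A).encard + 1 := Set.encard_insert_le _ _
    _ ≤ (n + 1 : ℕ) := by push_cast; gcongr

lemma IsStrong.exists_isStrong_of_mem_ball (hA : IsStrong G A) (hfin : A.Finite)
    (hx : x ∈ ball G A n) : ∃ B, A ⊆ B ∧ x ∈ B ∧ B.Finite ∧ IsStrong G B := by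
  induction n generalizing x with
  | zero => exact ⟨A, subset_rfl, hx, hfin, hA⟩
  | succ n ih =>
    rcases hx with hx | ⟨y, hy, hyx⟩
    · exact ih hx
    · obtain ⟨B, hAB, hyB, hBfin, hB⟩ := ih hy
      obtain ⟨C, hBC, hxC, hCfin, hC⟩ := hB.exists_isStrong_of_adj hBfin hyB hyx
      exact ⟨C, hAB.trans hBC, hxC, hCfin, hC⟩

/-- A vertex at finite distance is reached along a path, one neighbour at a time; one at infinite
distance can be added directly. -/
lemma IsStrong.exists_isStrong_mem (hA : IsStrong G A) (hfin : A.Finite) (x : V) :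
    ∃ B, A ⊆ B ∧ x ∈ B ∧ B.Finite ∧ IsStrong G B := by
  by_cases h : ∃ n, x ∈ ball G A n
  · obtain ⟨n, h⟩ := h
    exact hA.exists_isStrong_of_mem_ball hfin h
  · push Not at h
    exact ⟨insert x A, Set.subset_insert _ _, Set.mem_insert _ _, hfin.insert x,
      isStrong_iff_isNStrong.2 fun n => hA.isNStrong_insert_of_notMem_ball (h _)⟩

lemma IsFareyGraph.isStrong_empty (hG : IsFareyGraph G) : IsStrong G ∅ := by
  rw [isStrong_iff]
  intro C _ hne hfin
  rw [Set.sdiff_empty] at *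
  obtain ⟨x, hx⟩ := hG.exists_isRemovable C hfin hne
  exact ⟨x, hx.1, hx⟩

/-- Every finite set is contained in a finite strong set. -/
lemma IsFareyGraph.exists_isStrong_superset (hG : IsFareyGraph G) (hS : S.Finite) :
    ∃ B, S ⊆ B ∧ B.Finite ∧ IsStrong G B := by
  induction S, hS using Set.Finite.induction_on with
  | empty => exact ⟨∅, subset_rfl, Set.finite_empty, hG.isStrong_empty⟩
  | insert _ _ ih =>
    obtain ⟨B, hSB, hfin, hB⟩ := ih
    obtain ⟨C, hBC, hx, hC⟩ := hB.exists_isStrong_mem hfin _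
    exact ⟨C, Set.insert_subset hx (hSB.trans hBC), hC⟩

/-! ### Vertices far from a finite set -/

/-- Lipschitz functions extend along strong extensions. -/
lemma IsStrong.exists_lipschitz_extension (hA : IsStrong G A) (hC : A ⊆ C) (hfin : (C \ A).Finite)
    (f : V → ℕ) (hf : ∀ x ∈ A, ∀ y ∈ A, G.Adj x y → f x ≤ f y + 1) :
    ∃ g : V → ℕ, (∀ x ∈ A, g x = f x) ∧ ∀ x ∈ C, ∀ y ∈ C, G.Adj x y → g x ≤ g y + 1 := by
  classical
  induction h : (C \ A).ncard generalizing C with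
  | zero =>
    rw [Set.ncard_eq_zero hfin, Set.sdiff_eq_empty] at h
    exact ⟨f, fun _ _ => rfl, fun x hx y hy => hf x (h hx) y (h hy)⟩
  | succ n ih =>
    obtain ⟨c, hc, hcr⟩ := hA.exists_isRemovable hC
      (Set.nonempty_of_ncard_ne_zero (by omega)) hfin
    have hdiff : (C \ A) \ {c} = (C \ {c}) \ A := by grind
    obtain ⟨g, hg, hgC⟩ := ih (C := C \ {c}) (by grind) (hfin.subset (by grind)) (by
      rw [← hdiff, Set.ncard_sdiff_singleton_of_mem hc]
      omega)
    -- The neighbours of a removable vertex are pairwise adjacent, so their values differ by at most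
    -- one and the value of any of them can be reused. With no neighbour, `0` is a dummy value.
    obtain ⟨k, hk⟩ : ∃ k, ∀ z ∈ C, G.Adj c z → g z ≤ k + 1 ∧ k ≤ g z + 1 := by
      have aux : ∀ z ∈ C, G.Adj c z → z ∈ G.neighborSet c ∩ C := fun z hz h => ⟨h, hz⟩
      rcases hcr.cases with h | ⟨w, h⟩ | ⟨u, v, h, huv⟩
      · exact ⟨0, fun z hz hcz => by simpa [h] using aux z hz hcz⟩
      · refine ⟨g w, fun z hz hcz => ?_⟩
        have : z = w := by simpa [h] using aux z hz hcz
        subst this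
        omega
      · have hu : u ∈ G.neighborSet c ∩ C := by simp [h]
        have hv : v ∈ G.neighborSet c ∩ C := by simp [h]
        have hu' : u ∈ C \ {c} := ⟨hu.2, fun h => G.ne_of_adj hu.1 h.symm⟩
        have hv' : v ∈ C \ {c} := ⟨hv.2, fun h => G.ne_of_adj hv.1 h.symm⟩
        have h1 := hgC u hu' v hv' huv
        have h2 := hgC v hv' u hu' huv.symm
        refine ⟨g u, fun z hz hcz => ?_⟩
        have : z = u ∨ z = v := by simpa [h] using aux z hz hcz
        rcases this with rfl | rfl <;> omega
    refine ⟨Function.update g c k, fun x hx => ?_, fun x hx y hy hxy => ?_⟩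
    · rw [Function.update_of_ne (by grind), hg x hx]
    · by_cases hxc : x = c
      · subst hxc
        rw [Function.update_self, Function.update_of_ne hxy.ne.symm]
        exact (hk y hy hxy).2
      · rw [Function.update_of_ne hxc]
        by_cases hyc : y = c
        · subst hyc
          rw [Function.update_self]
          exact (hk x hx hxy.symm).1
        · rw [Function.update_of_ne hyc]
          exact hgC x ⟨hx, hxc⟩ y ⟨hy, hyc⟩ hxy

/-- `P` collects the vertices other than `x` on a path of length at most `n` from `A` to `x`; along
it `f` grows by at most one per edge. -/
lemma le_of_mem_ball (hx : x ∈ ball G A n) : ∃ P : Set V, P.Finite ∧ ∀ C, P ⊆ C →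
    ∀ f : V → ℕ, (∀ y ∈ A, f y = 0) → (∀ y ∈ C, ∀ z ∈ C, G.Adj y z → f y ≤ f z + 1) →
      x ∈ C → f x ≤ n := by
  induction n generalizing x with
  | zero => exact ⟨∅, Set.finite_empty, fun C _ f hf _ _ => (hf x hx).le⟩
  | succ n ih =>
    rcases hx with hx | ⟨y, hy, hyx⟩
    · obtain ⟨P, hP, h⟩ := ih hx
      exact ⟨P, hP, fun C hC f hf hf' hxC => (h C hC f hf hf' hxC).trans (Nat.le_succ n)⟩
    · obtain ⟨P, hP, h⟩ := ih hy
      refine ⟨insert y P, hP.insert y, fun C hC f hf hf' hxC => ?_⟩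
      have h1 := h C ((Set.subset_insert _ _).trans hC) f hf hf' (hC (Or.inl rfl))
      have h2 := hf' x hxC y (hC (Or.inl rfl)) hyx.symm
      omega

/-- If strong extensions by pendant vertices exist, then so do vertices that are arbitrarily far
from a given finite strong set. -/
lemma IsStrong.exists_notMem_ball (hA : IsStrong G A) (hfin : A.Finite) (hne : A.Nonempty)
    (hpend : ∀ B a, B.Finite → IsStrong G B → a ∈ B →
      ∃ x, x ∉ B ∧ G.neighborSet x ∩ B = {a} ∧ IsStrong G (insert x B)) (n : ℕ) :
    ∃ x, x ∉ ball G A n := by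
  classical
  -- Attach a pendant vertex to one of value `k` and give it the value `k + 1`; its only neighbour
  -- has value `k`, so `f` stays Lipschitz.
  have key : ∀ k : ℕ, ∃ (B : Set V) (f : V → ℕ), A ⊆ B ∧ B.Finite ∧ IsStrong G B ∧
      (∀ x ∈ A, f x = 0) ∧ (∀ x ∈ B, ∀ y ∈ B, G.Adj x y → f x ≤ f y + 1) ∧
      ∃ x ∈ B, f x = k := by
    intro k
    induction k with
    | zero =>
      obtain ⟨a, ha⟩ := hne
      exact ⟨A, fun _ => 0, subset_rfl, hfin, hA, fun _ _ => rfl, by simp, a, ha, rfl⟩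
    | succ k ih =>
      obtain ⟨B, f, hAB, hBfin, hB, hf0, hf, a, ha, hfa⟩ := ih
      obtain ⟨x, hxB, hN, hx⟩ := hpend B a hBfin hB ha
      have hN' : ∀ y ∈ B, G.Adj x y → y = a := fun y hy hxy => by
        have : y ∈ G.neighborSet x ∩ B := ⟨hxy, hy⟩
        simpa [hN] using this
      refine ⟨insert x B, Function.update f x (k + 1), hAB.trans (Set.subset_insert _ _),
        hBfin.insert x, hx, fun y hy => ?_, fun y hy z hz hyz => ?_, x, Or.inl rfl, by simp⟩
      · rw [Function.update_of_ne (by grind), hf0 y hy]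
      · by_cases hyx : y = x
        · subst hyx
          have hz : z ∈ B := hz.resolve_left hyz.ne.symm
          rw [Function.update_self, Function.update_of_ne hyz.ne.symm, hN' z hz hyz, hfa]
        · rw [Function.update_of_ne hyx]
          by_cases hzx : z = x
          · subst hzx
            rw [Function.update_self, hN' y (hy.resolve_left hyx) hyz.symm, hfa]
            omega
          · rw [Function.update_of_ne hzx]
            exact hf y (hy.resolve_left hyx) z (hz.resolve_left hzx) hyz
  obtain ⟨B, f, hAB, hBfin, hB, hf0, hf, x, hx, hfx⟩ := key (n + 1)
  refine ⟨x, fun hxn => ?_⟩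
  obtain ⟨P, hP, h⟩ := le_of_mem_ball hxn
  -- A path of length at most `n` from `A` to `x` may leave `B`; extending `f` over it would still
  -- force `n + 1 ≤ n`.
  obtain ⟨g, hgB, hg⟩ := hB.exists_lipschitz_extension (C := B ∪ P) Set.subset_union_left
    (hP.subset (by grind)) f hf
  have := h (B ∪ P) Set.subset_union_right g (fun y hy => (hgB y (hAB hy)).trans (hf0 y hy)) hg
    (Or.inl hx)
  rw [hgB x hx] at this
  omega

end Graph

/-! ### Extending strong embeddings -/

section Extension

variable {V W B : Type*} {G : SimpleGraph V} {H : SimpleGraph B}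

lemma neighborSet_inter_image (e : H ↪g G) (S : Set B) (x : B) :
    G.neighborSet (e x) ∩ e '' S = e '' (H.neighborSet x ∩ S) := by
  ext y
  constructor
  · rintro ⟨hy, z, hz, rfl⟩
    exact ⟨z, ⟨e.map_adj_iff.1 hy, hz⟩, rfl⟩
  · rintro ⟨z, ⟨hxz, hz⟩, rfl⟩
    exact ⟨e.map_adj_iff.2 hxz, z, hz, rfl⟩

lemma IsRemovable.of_image (e : H ↪g G) {S : Set B} {x : B} (h : IsRemovable G (e '' S) (e x)) :
    IsRemovable H S x := by
  refine ⟨e.injective.mem_set_image.1 h.1, ?_⟩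
  have h2 := h.2
  rw [neighborSet_inter_image, e.injective.encard_image] at h2
  refine h2.imp id ?_
  rintro ⟨y, z, hyz, hadj⟩
  obtain ⟨y, -, rfl⟩ : y ∈ e '' (H.neighborSet x ∩ S) := by simp [hyz]
  obtain ⟨z, -, rfl⟩ : z ∈ e '' (H.neighborSet x ∩ S) := by simp [hyz]
  rw [← Set.image_pair, e.injective.image_injective.eq_iff] at hyz
  exact ⟨y, z, hyz, e.map_adj_iff.1 hadj⟩

lemma IsStrong.of_image (e : H ↪g G) {A : Set B} (h : IsStrong G (e '' A)) : IsStrong H A := by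
  rw [isStrong_iff]
  intro C hC hne hfin
  obtain ⟨y, hy, hyr⟩ := h.exists_isRemovable (Set.image_mono hC)
    (by rw [← Set.image_sdiff e.injective]; exact hne.image _)
    (by rw [← Set.image_sdiff e.injective]; exact hfin.image _)
  rw [← Set.image_sdiff e.injective] at hy
  obtain ⟨x, hx, rfl⟩ := hy
  exact ⟨x, hx, hyr.of_image e⟩

lemma IsFareyGraph.inK (hG : IsFareyGraph G) [Finite B] (e : H ↪g G) : InK H := by
  refine ⟨inferInstance, fun x y hxy => ?_, fun S hS => ?_⟩
  · rw [← e.injective.encard_image, ← hG.encard_commonNeighbors _ _ (e.map_adj_iff.2 hxy)]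
    refine Set.encard_le_encard ?_
    rintro _ ⟨z, hz, rfl⟩
    exact ⟨e.map_adj_iff.2 hz.1, e.map_adj_iff.2 hz.2⟩
  · obtain ⟨y, hy⟩ := hG.exists_isRemovable (e '' S) (S.toFinite.image e) (hS.image e)
    obtain ⟨x, -, rfl⟩ := hy.1
    exact ⟨x, hy.of_image e⟩

/-- Finite strong sets have all the strong extensions by a vertex of degree at most one. -/
def HasPendantExtensions (G : SimpleGraph V) : Prop :=
  ∀ A Q : Set V, A.Finite → IsStrong G A → Q ⊆ A → Q.encard ≤ 1 →
    ∃ x, x ∉ A ∧ G.neighborSet x ∩ A = Q ∧ IsStrong G (insert x A)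

/-- A neighbourhood of size at most one is covered by `hext`. If it is an edge `cd`, compare
triangles: `H` has at most two on `cd`, one of them using `x ∉ D`, while `G` has exactly two on the
image edge, so one of their apexes avoids `g '' D`. -/
lemma IsFareyGraph.exists_isStrong_insert (hG : IsFareyGraph G) (hext : HasPendantExtensions G)
    (hH : InK H) {D : Set B} {x : B} (hr : IsRemovable H (insert x D) x) (hx : x ∉ D) {g : B → V}
    (hadj : ∀ u ∈ D, ∀ v ∈ D, G.Adj (g u) (g v) ↔ H.Adj u v)
    (hD : IsStrong G (g '' D)) :
    ∃ y, y ∉ g '' D ∧ G.neighborSet y ∩ g '' D = g '' (H.neighborSet x ∩ D) ∧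
      IsStrong G (insert y (g '' D)) := by
  have : Finite B := hH.1
  have hN : H.neighborSet x ∩ insert x D = H.neighborSet x ∩ D :=
    Set.inter_insert_of_notMem (by simp)
  have h2 := hr.2
  rw [hN] at h2
  rcases h2 with h | ⟨c, d, h, hcd⟩
  · exact hext _ _ (D.toFinite.image g) hD (Set.image_mono Set.inter_subset_right)
      ((Set.encard_image_le _ _).trans h)
  have hc : c ∈ H.neighborSet x ∩ D := by simp [h]
  have hd : d ∈ H.neighborSet x ∩ D := by simp [h]
  have hgcd := (hadj c hc.2 d hd.2).2 hcd
  obtain ⟨y, hy, hyD⟩ : ∃ y ∈ G.commonNeighbors (g c) (g d), y ∉ g '' D := by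
    by_contra! hcon
    have hsub : G.commonNeighbors (g c) (g d) ⊆ g '' (H.commonNeighbors c d ∩ D) := by
      intro z hz
      obtain ⟨z, hzD, rfl⟩ := hcon z hz
      exact ⟨z, ⟨⟨(hadj c hc.2 z hzD).1 hz.1, (hadj d hd.2 z hzD).1 hz.2⟩, hzD⟩, rfl⟩
    have h1 : 2 ≤ (H.commonNeighbors c d ∩ D).encard := by
      rw [← hG.encard_commonNeighbors _ _ hgcd]
      exact (Set.encard_le_encard hsub).trans (Set.encard_image_le _ _)
    have h3 : insert x (H.commonNeighbors c d ∩ D) ⊆ H.commonNeighbors c d :=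
      Set.insert_subset ⟨hc.1.symm, hd.1.symm⟩ Set.inter_subset_left
    have h4 := (Set.encard_le_encard h3).trans (hH.2.1 c d hcd)
    rw [Set.encard_insert_of_notMem (fun h => hx h.2)] at h4
    have h5 := (add_le_add_left h1 1).trans h4
    norm_num at h5
  have hcD := Set.mem_image_of_mem g hc.2
  have hdD := Set.mem_image_of_mem g hd.2
  refine ⟨y, hyD, ?_, hD.insert_of_adj_of_adj hyD hcD hy.1.symm hdD hy.2.symm hgcd.ne⟩
  rw [(hD.neighborSet_inter_eq_pair hyD hcD hy.1.symm hdD hy.2.symm hgcd.ne).1, h, Set.image_pair]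

/-- Induction on the size of `C \ A`, peeling off a removable vertex and re-embedding it last. The
map `g` is total on `B`, but only its values on `C` matter. -/
lemma IsFareyGraph.exists_strong_extension [Nonempty V] (hG : IsFareyGraph G)
    (hext : HasPendantExtensions G) (hH : InK H) {A : Set B} (hA : IsStrong H A)
    (f : H.induce A ↪g G) (hf : IsStrong G (Set.range f)) {C : Set B} (hC : A ⊆ C) :
    ∃ g : B → V, (∀ a : A, g a = f a) ∧ Set.InjOn g C ∧
      (∀ u ∈ C, ∀ v ∈ C, G.Adj (g u) (g v) ↔ H.Adj u v) ∧ IsStrong G (g '' C) := by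
  classical
  have : Finite B := hH.1
  induction h : (C \ A).ncard generalizing C with
  | zero =>
    rw [Set.ncard_eq_zero, Set.sdiff_eq_empty] at h
    obtain rfl : A = C := hC.antisymm h
    let g : B → V := fun b => if h : b ∈ A then f ⟨b, h⟩ else Classical.arbitrary V
    have hg : ∀ a : A, g a = f a := fun a => by simp [g]
    refine ⟨g, hg, fun u hu v hv huv => ?_, fun u hu v hv => ?_, ?_⟩
    · rw [hg ⟨u, hu⟩, hg ⟨v, hv⟩] at huv
      exact congrArg Subtype.val (f.injective huv)
    · rw [hg ⟨u, hu⟩, hg ⟨v, hv⟩]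
      exact f.map_adj_iff
    · convert hf
      ext y
      constructor
      · rintro ⟨u, hu, rfl⟩
        exact ⟨⟨u, hu⟩, (hg ⟨u, hu⟩).symm⟩
      · rintro ⟨u, rfl⟩
        exact ⟨u, u.2, hg u⟩
  | succ n ih =>
    obtain ⟨x, hx, hxr⟩ := hA.exists_isRemovable hC
      (Set.nonempty_of_ncard_ne_zero (by omega)) (Set.toFinite _)
    obtain ⟨g, hgf, hinj, hadj, hstr⟩ := ih (C := C \ {x}) (by grind) (by
      rw [show (C \ {x}) \ A = (C \ A) \ {x} by grind, Set.ncard_sdiff_singleton_of_mem hx]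
      omega)
    obtain ⟨D, rfl, hxD⟩ : ∃ D, C = insert x D ∧ x ∉ D := ⟨C \ {x}, by grind, by simp⟩
    have hDx : insert x D \ {x} = D := by grind
    rw [hDx] at hinj hadj hstr
    obtain ⟨y, hy, hN, hystr⟩ := hG.exists_isStrong_insert hext hH hxr hxD hadj hstr
    have hgD : ∀ u ∈ D, Function.update g x y u = g u := fun u hu =>
      Function.update_of_ne (by rintro rfl; exact hxD hu) _ _
    have hyadj : ∀ u ∈ D, G.Adj y (g u) ↔ H.Adj x u := by
      intro u hu
      constructor
      · intro h
        have : g u ∈ G.neighborSet y ∩ g '' D := ⟨h, u, hu, rfl⟩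
        rw [hN] at this
        obtain ⟨w, hw, hwu⟩ := this
        exact hinj hw.2 hu hwu ▸ hw.1
      · intro h
        have : g u ∈ g '' (H.neighborSet x ∩ D) := ⟨u, ⟨h, hu⟩, rfl⟩
        rw [← hN] at this
        exact this.1
    have himage : Function.update g x y '' D = g '' D := Set.image_congr hgD
    refine ⟨Function.update g x y, fun a => ?_, ?_, ?_, ?_⟩
    · rw [Function.update_of_ne (by rintro rfl; exact hx.2 a.2), hgf]
    · rw [Set.injOn_insert hxD, himage, Function.update_self]
      exact ⟨hinj.congr fun u hu => (hgD u hu).symm, hy⟩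
    · rintro u (rfl | hu) v (rfl | hv)
      · simp
      · rw [hgD v hv, Function.update_self]
        exact hyadj v hv
      · rw [hgD u hu, Function.update_self, G.adj_comm, H.adj_comm]
        exact hyadj u hu
      · rw [hgD u hu, hgD v hv]
        exact hadj u hu v hv
    · rw [Set.image_insert_eq, himage, Function.update_self]
      exact hystr

/-- One-vertex extensions suffice for `K`-saturation. -/
theorem IsFareyGraph.isKSaturated [Nonempty V] (hG : IsFareyGraph G)
    (hext : HasPendantExtensions G) : IsKSaturated G := by
  refine ⟨fun S hS => ?_, fun B H A hH _ hA f hf => ?_⟩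
  · have : Finite S := hS
    exact hG.inK (SimpleGraph.Embedding.induce S)
  · obtain ⟨g, hgf, hinj, hadj, hstr⟩ :=
      hG.exists_strong_extension hext hH hA f hf (Set.subset_univ A)
    refine ⟨⟨⟨g, fun u v h => hinj (Set.mem_univ u) (Set.mem_univ v) h⟩, ?_⟩, ?_, hgf⟩
    · intro u v
      exact hadj u (Set.mem_univ u) v (Set.mem_univ v)
    · rw [Set.image_univ] at hstr
      exact hstr

/-! ### Back and forth -/

/-- The tuples `v` and `w` are images of one tuple of a finite graph under strong embeddings. -/
def StronglyIsomorphic (G : SimpleGraph V) (G' : SimpleGraph W) {J : Type*} (v : J → V)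
    (w : J → W) : Prop :=
  ∃ (B : Type) (H : SimpleGraph B) (e : H ↪g G) (e' : H ↪g G') (t : J → B), Finite B ∧
    IsStrong G (Set.range e) ∧ IsStrong G' (Set.range e') ∧ (∀ j, v j = e (t j)) ∧
      ∀ j, w j = e' (t j)

variable {G' : SimpleGraph W} {J K : Type*} {v : J → V} {w : J → W}

lemma StronglyIsomorphic.symm (h : StronglyIsomorphic G G' v w) : StronglyIsomorphic G' G w v := by
  obtain ⟨B, H, e, e', t, h1, h2, h3, h4, h5⟩ := h
  exact ⟨B, H, e', e, t, h1, h3, h2, h5, h4⟩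

lemma StronglyIsomorphic.comp (h : StronglyIsomorphic G G' v w) (f : K → J) :
    StronglyIsomorphic G G' (v ∘ f) (w ∘ f) := by
  obtain ⟨B, H, e, e', t, h1, h2, h3, h4, h5⟩ := h
  exact ⟨B, H, e, e', t ∘ f, h1, h2, h3, fun k => h4 (f k), fun k => h5 (f k)⟩

lemma StronglyIsomorphic.adj_iff (h : StronglyIsomorphic G G' v w) (i j : J) :
    G.Adj (v i) (v j) ↔ G'.Adj (w i) (w j) := by
  obtain ⟨B, H, e, e', t, h1, h2, h3, h4, h5⟩ := h
  rw [h4, h4, h5, h5, e.map_adj_iff, e'.map_adj_iff]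

lemma StronglyIsomorphic.eq_iff (h : StronglyIsomorphic G G' v w) (i j : J) :
    v i = v j ↔ w i = w j := by
  obtain ⟨B, H, e, e', t, h1, h2, h3, h4, h5⟩ := h
  rw [h4, h4, h5, h5, e.injective.eq_iff, e'.injective.eq_iff]

/-- The forth step: enlarge the range of `e` to a finite strong set containing `x`, then extend `e'`
over it by `K`-saturation of `G'`. -/
lemma StronglyIsomorphic.extend (h : StronglyIsomorphic G G' v w) (hG : IsFareyGraph G)
    (hG' : IsKSaturated G') (x : V) :
    ∃ y, StronglyIsomorphic G G' (Sum.elim v fun _ : Unit => x) (Sum.elim w fun _ : Unit => y) := by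
  obtain ⟨B, H, e, e', t, hB, he, he', hv, hw⟩ := h
  obtain ⟨C, hBC, hxC, hCfin, hC⟩ := he.exists_isStrong_mem (Set.finite_range e) x
  have : Finite C := hCfin
  -- `C` is copied onto `Fin n` because `IsKSaturated` tests only graphs on a `Type`, whereas `V`
  -- may live in any universe.
  obtain ⟨n, ⟨i⟩⟩ := Finite.exists_equiv_fin C
  let k : Fin n → V := fun m => i.symm m
  have hk : Function.Injective k := Subtype.val_injective.comp i.symm.injective
  have hrange : Set.range k = C := by
    ext z
    exact ⟨by rintro ⟨m, rfl⟩; exact (i.symm m).2, fun hz => ⟨i ⟨z, hz⟩, by simp [k]⟩⟩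
  let H' : SimpleGraph (Fin n) := G.comap k
  let ek : H' ↪g G := ⟨⟨k, hk⟩, Iff.rfl⟩
  have hek : Set.range ek = C := hrange
  have hlift : ∀ b, ∃ m, ek m = e b := fun b => by
    have : e b ∈ Set.range ek := hek ▸ hBC ⟨b, rfl⟩
    exact this
  choose s hs using hlift
  have hsurj : ∀ a : Set.range s, ∃ b, s b = a := fun a => a.2
  choose r hr using hsurj
  have hA : ek '' Set.range s = Set.range e := by
    rw [← Set.range_comp]
    exact congrArg Set.range (funext hs)
  have hrs : ∀ b h, r ⟨s b, h⟩ = b := fun b h => by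
    apply e.injective
    rw [← hs, ← hs, hr]
  let f : H'.induce (Set.range s) ↪g G' :=
    ⟨⟨fun a => e' (r a), fun a b hab => by
      have := e'.injective hab
      exact Subtype.ext (by rw [← hr a, ← hr b, this])⟩, fun {a b} => by
      change G'.Adj (e' (r a)) (e' (r b)) ↔ G.Adj (ek a) (ek b)
      rw [e'.map_adj_iff, ← hr a, ← hr b, hs, hs, e.map_adj_iff]⟩
  have hf : Set.range f = Set.range e' := by
    ext z
    constructor
    · rintro ⟨a, rfl⟩
      exact ⟨r a, rfl⟩
    · rintro ⟨b, rfl⟩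
      exact ⟨⟨s b, b, rfl⟩, congrArg e' (hrs b _)⟩
  obtain ⟨g, hg, hgf⟩ := hG'.2 (Fin n) H' (Set.range s) (hG.inK ek)
    (hG.inK (ek.comp (SimpleGraph.Embedding.induce _))) (.of_image ek (hA ▸ he)) f (hf ▸ he')
  obtain ⟨c, hc⟩ : x ∈ Set.range ek := hek ▸ hxC
  refine ⟨g c, Fin n, H', ek, g, Sum.elim (s ∘ t) fun _ => c, inferInstance, hek ▸ hC, hg, ?_, ?_⟩
  · rintro (j | _)
    · exact (hv j).trans (hs _).symm
    · exact hc.symm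
  · rintro (j | _)
    · refine (hw j).trans ?_
      refine Eq.trans ?_ (hgf ⟨s (t j), t j, rfl⟩).symm
      exact (congrArg e' (hrs _ _)).symm
    · rfl

end Extension

/-! ### Formulas -/

section Formulas

variable {V W J α : Type*}

/-- The formula `E(xᵢ, xⱼ)`. -/
def adjFormula (i j : J) : Language.graph.Formula J :=
  adj.formula₂ (Term.var i) (Term.var j)

/-- The formula `xᵢ = xⱼ`. -/
def eqFormula (i j : J) : Language.graph.Formula J :=
  (Term.var i).equal (Term.var j)

/-- The formula saying that `xᵢ` is removable from the subgraph on all the variables. -/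
noncomputable def isRemovableFormula [Finite J] (i : J) : Language.graph.Formula J :=
  (Formula.iSup fun j : J => Formula.iInf fun k : J => (adjFormula i k).imp (eqFormula k j)) ⊔
    Formula.iSup fun j : J => Formula.iSup fun k : J =>
      ((adjFormula i j ⊓ adjFormula i k) ⊓ adjFormula j k) ⊓
        Formula.iInf fun l : J => (adjFormula i l).imp (eqFormula l j ⊔ eqFormula l k)

/-- The formula saying that `xᵢ` is different from all the variables in a given family. -/
noncomputable def notMemFormula [Finite α] (f : α → J) (i : J) : Language.graph.Formula J :=
  Formula.iInf fun a : α => ∼(eqFormula i (f a))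

/-- The formula saying that the subgraph on all the variables is strong with respect to extensions
by at most `n` vertices. -/
noncomputable def isNStrongFormula (J : Type*) [Finite J] (n : ℕ) : Language.graph.Formula J :=
  Formula.iAlls (Fin n)
    ((Formula.iSup fun i : Fin n => notMemFormula Sum.inl (Sum.inr i)).imp
      (Formula.iSup fun i : Fin n => notMemFormula Sum.inl (Sum.inr i) ⊓
        isRemovableFormula (Sum.inr i)))

/-- The formula saying that `xᵢ` is not in a given family of variables and that it is adjacent
exactly to those members of the family that lie in `Q`. -/
noncomputable def neighborsFormula [Finite α] (f : α → J) (Q : Set α) (i : J) :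
    Language.graph.Formula J :=
  open Classical in
  notMemFormula f i ⊓
    Formula.iInf fun a : α => if a ∈ Q then adjFormula i (f a) else ∼(adjFormula i (f a))

variable [Language.graph.Structure V]

lemma realize_eqFormula (i j : J) (v : J → V) : (eqFormula i j).Realize v ↔ v i = v j := by
  simp [eqFormula]

lemma realize_notMemFormula [Finite α] (f : α → J) (i : J) (v : J → V) :
    (notMemFormula f i).Realize v ↔ v i ∉ Set.range (v ∘ f) := by
  simp [notMemFormula, realize_eqFormula, eq_comm]

variable [V ⊨ Theory.simpleGraph]

lemma realize_adjFormula (i j : J) (v : J → V) :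
    (adjFormula i j).Realize v ↔ (simpleGraphOfStructure V).Adj (v i) (v j) := by
  simp [adjFormula, Formula.realize_rel₂]

lemma realize_isRemovableFormula [Finite J] (i : J) (v : J → V) :
    (isRemovableFormula i).Realize v ↔
      IsRemovable (simpleGraphOfStructure V) (Set.range v) (v i) := by
  simp only [isRemovableFormula, Formula.realize_sup, Formula.realize_iSup, Formula.realize_iInf,
    Formula.realize_imp, Formula.realize_inf, realize_adjFormula, realize_eqFormula]
  set G := simpleGraphOfStructure V
  simp only [IsRemovable, Set.mem_range_self, true_and]
  refine or_congr ?_ ?_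
  · rw [Set.encard_le_one_iff]
    constructor
    · rintro ⟨j, hj⟩ _ _ ⟨h1, a, rfl⟩ ⟨h2, b, rfl⟩
      exact (hj _ h1).trans (hj _ h2).symm
    · intro h
      by_cases hk : ∃ k, G.Adj (v i) (v k)
      · obtain ⟨k, hk⟩ := hk
        exact ⟨k, fun l hl => h _ _ ⟨hl, l, rfl⟩ ⟨hk, k, rfl⟩⟩
      · exact ⟨i, fun l hl => (hk ⟨l, hl⟩).elim⟩
  · simp only [Set.ext_iff, Set.mem_inter_iff, SimpleGraph.mem_neighborSet, Set.mem_range,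
      Set.mem_insert_iff, Set.mem_singleton_iff]
    constructor
    · rintro ⟨j, k, ⟨⟨h1, h2⟩, h3⟩, h4⟩
      refine ⟨v j, v k, fun x => ⟨?_, ?_⟩, h3⟩
      · rintro ⟨h, l, rfl⟩
        exact h4 l h
      · rintro (rfl | rfl)
        exacts [⟨h1, _, rfl⟩, ⟨h2, _, rfl⟩]
    · rintro ⟨y, z, h, h3⟩
      obtain ⟨h1, j, rfl⟩ := (h y).2 (Or.inl rfl)
      obtain ⟨h2, k, rfl⟩ := (h z).2 (Or.inr rfl)
      exact ⟨j, k, ⟨⟨h1, h2⟩, h3⟩, fun l hl => (h _).1 ⟨hl, l, rfl⟩⟩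

lemma realize_isNStrongFormula [Finite J] (n : ℕ) (v : J → V) :
    (isNStrongFormula J n).Realize v ↔
      IsNStrong (simpleGraphOfStructure V) n (Set.range v) := by
  simp only [isNStrongFormula, Formula.realize_iAlls, Formula.realize_imp, Formula.realize_iSup,
    Formula.realize_inf, realize_notMemFormula, realize_isRemovableFormula, Sum.elim_inr]
  have h1 : ∀ y : Fin n → V, (fun a => Sum.elim v y a) ∘ Sum.inl = v := fun y => rfl
  have h2 : ∀ y : Fin n → V, Set.range (fun a => Sum.elim v y a) = Set.range v ∪ Set.range y :=
    fun y => Set.Sum.elim_range v y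
  simp only [h1, h2]
  constructor
  · intro h C hC hne hcard
    -- A nonempty set of at most `n` vertices is enumerated by `Fin n` with repetitions.
    obtain ⟨y, hy⟩ : ∃ y : Fin n → V, Set.range y = C \ Set.range v := by
      have hfin : (C \ Set.range v).Finite := Set.finite_of_encard_le_coe hcard
      have := hfin.fintype
      have : Nonempty ↥(C \ Set.range v) := hne.to_subtype
      have hn : Fintype.card ↥(C \ Set.range v) ≤ Fintype.card (Fin n) := by
        rw [Fintype.card_fin, ← Nat.card_eq_fintype_card, Nat.card_coe_set_eq]
        rw [← hfin.cast_ncard_eq] at hcard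
        exact_mod_cast hcard
      obtain ⟨e⟩ := Function.Embedding.nonempty_of_card_le hn
      refine ⟨fun i => (Function.invFun e i : ↥(C \ Set.range v)), ?_⟩
      ext z
      constructor
      · rintro ⟨i, rfl⟩
        exact Subtype.prop _
      · intro hz
        exact ⟨e ⟨z, hz⟩, congrArg Subtype.val (Function.leftInverse_invFun e.injective _)⟩
    have hCv : Set.range v ∪ Set.range y = C := by rw [hy, Set.union_sdiff_cancel hC]
    have := h y
    rw [hCv] at this
    obtain ⟨z, hz⟩ := hne
    rw [← hy] at hz
    obtain ⟨i, rfl⟩ := hz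
    have hyi : ∀ i, y i ∈ C \ Set.range v := fun i => hy ▸ Set.mem_range_self i
    obtain ⟨j, hj, hjr⟩ := this ⟨i, (hyi i).2⟩
    exact ⟨y j, hyi j, hjr⟩
  · rintro h y ⟨i, hi⟩
    obtain ⟨z, hz, hzr⟩ := h (Set.range v ∪ Set.range y) Set.subset_union_left
      ⟨y i, Or.inr ⟨i, rfl⟩, hi⟩ (by
        calc _ ≤ (Set.range y).encard := Set.encard_le_encard (by grind)
          _ ≤ (Set.univ : Set (Fin n)).encard := by
            rw [← Set.image_univ]
            exact Set.encard_image_le _ _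
          _ = n := by simp [Set.encard_univ])
    obtain ⟨j, rfl⟩ := hz.1.resolve_left hz.2
    exact ⟨j, hz.2, hzr⟩

lemma realize_neighborsFormula [Finite α] (f : α → J) (Q : Set α) (i : J) (v : J → V)
    (hv : Function.Injective (v ∘ f)) : (neighborsFormula f Q i).Realize v ↔
      v i ∉ Set.range (v ∘ f) ∧
        (simpleGraphOfStructure V).neighborSet (v i) ∩ Set.range (v ∘ f) = (v ∘ f) '' Q := by
  classical
  simp only [neighborsFormula, Formula.realize_inf, realize_notMemFormula, Formula.realize_iInf]
  refine and_congr_right fun _ => ?_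
  have : ∀ a, (if a ∈ Q then adjFormula i (f a) else ∼(adjFormula i (f a))).Realize v ↔
      ((simpleGraphOfStructure V).Adj (v i) (v (f a)) ↔ a ∈ Q) := by
    intro a
    split_ifs with h
    · simp [realize_adjFormula, -simpleGraphOfStructure_adj, h]
    · rw [Formula.realize_not, realize_adjFormula]
      simp [-simpleGraphOfStructure_adj, h]
  simp only [this]
  constructor
  · intro h
    ext z
    constructor
    · rintro ⟨hz, a, rfl⟩
      exact ⟨a, (h a).1 hz, rfl⟩
    · rintro ⟨a, ha, rfl⟩
      exact ⟨(h a).2 ha, a, rfl⟩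
  · intro h a
    rw [← hv.mem_set_image (s := Q), ← h]
    simp [-simpleGraphOfStructure_adj]

/-- Exhibits the valuation under a quantifier as a reindexed one-point extension, so that
`StronglyIsomorphic.comp` applies. -/
lemma sumElim_snoc {X : Type*} {n : ℕ} (v : J → X) (x : Fin n → X) (a : X) :
    Sum.elim v (Fin.snoc x a : Fin (n + 1) → X) =
      Sum.elim (Sum.elim v x) (fun _ : Unit => a) ∘
        Sum.elim (fun j => Sum.inl (Sum.inl j))
          (Fin.snoc (fun i => Sum.inl (Sum.inr i)) (Sum.inr ()) : Fin (n + 1) → _) := by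
  ext (j | i)
  · rfl
  · induction i using Fin.lastCases <;> simp

lemma sumElim_fin_zero {X : Type*} (v : J → X) (x : Fin 0 → X) :
    Sum.elim v x = v ∘ Sum.elim id Fin.elim0 := by
  ext (j | i)
  · rfl
  · exact i.elim0

variable [Language.graph.Structure W] [W ⊨ Theory.simpleGraph]

/-- Tuples that correspond to each other under strong embeddings of a finite graph have the same
type. -/
lemma StronglyIsomorphic.realize_boundedFormula_iff
    (hV : IsFareyGraph (simpleGraphOfStructure V)) (hW : IsFareyGraph (simpleGraphOfStructure W))
    (hV' : IsKSaturated (simpleGraphOfStructure V)) (hW' : IsKSaturated (simpleGraphOfStructure W))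
    {n : ℕ} (φ : Language.graph.BoundedFormula J n) {v : J → V} {w : J → W} {x : Fin n → V}
    {y : Fin n → W} (h : StronglyIsomorphic (simpleGraphOfStructure V) (simpleGraphOfStructure W)
      (Sum.elim v x) (Sum.elim w y)) : φ.Realize v x ↔ φ.Realize w y := by
  -- The language has no function symbols.
  have hterm : ∀ {n : ℕ} (t : Language.graph.Term (J ⊕ Fin n)), ∃ i, t = Term.var i := by
    rintro n (i | ⟨f, -⟩)
    · exact ⟨i, rfl⟩
    · exact f.elim
  induction φ with
  | falsum => rfl
  | equal s t =>
    obtain ⟨i, rfl⟩ := hterm s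
    obtain ⟨j, rfl⟩ := hterm t
    exact h.eq_iff i j
  | rel R ts =>
    obtain ⟨⟩ := R
    choose i hi using fun m => hterm (ts m)
    obtain rfl : ts = fun m => Term.var (i m) := funext hi
    have := h.adj_iff (i 0) (i 1)
    simp only [simpleGraphOfStructure_adj] at this
    refine (iff_of_eq (congrArg (Structure.RelMap adj) ?_)).trans
      (this.trans (iff_of_eq (congrArg (Structure.RelMap adj) ?_))) <;>
    · ext m
      fin_cases m <;> rfl
  | imp _ _ ih₁ ih₂ => exact imp_congr (ih₁ h) (ih₂ h)
  | @all n φ ih =>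
    simp only [BoundedFormula.realize_all]
    constructor
    · intro hφ b
      obtain ⟨a, ha⟩ := h.symm.extend hW hV' b
      refine (ih ?_).1 (hφ a)
      rw [sumElim_snoc v, sumElim_snoc w]
      exact ha.symm.comp _
    · intro hφ a
      obtain ⟨b, hb⟩ := h.extend hV hW' a
      refine (ih ?_).2 (hφ b)
      rw [sumElim_snoc v, sumElim_snoc w]
      exact hb.comp _

lemma StronglyIsomorphic.realize_formula_iff
    (hV : IsFareyGraph (simpleGraphOfStructure V)) (hW : IsFareyGraph (simpleGraphOfStructure W))
    (hV' : IsKSaturated (simpleGraphOfStructure V)) (hW' : IsKSaturated (simpleGraphOfStructure W))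
    (φ : Language.graph.Formula J) {v : J → V} {w : J → W}
    (h : StronglyIsomorphic (simpleGraphOfStructure V) (simpleGraphOfStructure W) v w) :
    φ.Realize v ↔ φ.Realize w := by
  refine StronglyIsomorphic.realize_boundedFormula_iff hV hW hV' hW' φ ?_
  rw [sumElim_fin_zero v, sumElim_fin_zero w]
  exact h.comp _

end Formulas

/-! ### Saturation of ultrapowers -/

section Ultrapower

open Filter

variable {L : Language} {M α : Type*} [L.Structure M] [Nonempty M]

lemma realize_ultrapower_const (φ : L.Formula α) (v : α → M) :
    φ.Realize (fun a => (Quotient.mk _ fun _ => v a :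
      (hyperfilter ℕ : Filter ℕ).Product fun _ => M)) ↔ φ.Realize v := by
  refine (Ultraproduct.realize_formula_cast (u := hyperfilter ℕ) φ fun a _ => v a).trans ?_
  simp

variable [Countable L.Symbols]

/-- Countable ultrapowers realize the countable types that are finitely satisfiable in them. -/
lemma ultrapower_exists_realize [Countable α]
    (v : α → (hyperfilter ℕ : Filter ℕ).Product fun _ => M) (p : Set (L.Formula (α ⊕ Unit)))
    (hp : ∀ q ⊆ p, q.Finite → ∃ b, ∀ φ ∈ q, φ.Realize (Sum.elim v fun _ => b)) :
    ∃ b, ∀ φ ∈ p, φ.Realize (Sum.elim v fun _ => b) := by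
  choose x hx using fun a => Quotient.mk_surjective (v a)
  obtain rfl := funext hx
  obtain ⟨e, he⟩ := exists_injective_nat (L.Formula (α ⊕ Unit))
  have los : ∀ (y : ℕ → M) (φ : L.Formula (α ⊕ Unit)),
      φ.Realize (Sum.elim (fun a => (Quotient.mk _ (x a) : (hyperfilter ℕ : Filter ℕ).Product
        fun _ => M)) fun _ => Quotient.mk _ y) ↔
      ∀ᶠ i in (hyperfilter ℕ : Filter ℕ), φ.Realize (Sum.elim (fun a => x a i) fun _ => y i) := by
    intro y φ
    have := Ultraproduct.realize_formula_cast (u := hyperfilter ℕ) φ (Sum.elim x fun _ => y)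
    have h1 : ∀ i : ℕ, (fun j : α ⊕ Unit => Sum.elim x (fun _ => y) j i) =
        Sum.elim (fun a => x a i) fun _ => y i := fun i => by ext (_ | _) <;> rfl
    simp only [h1] at this
    rw [← this]
    refine iff_of_eq (congrArg _ ?_)
    ext (_ | _) <;> rfl
  -- In coordinate `i`, `b` satisfies the formulas of `p` with code at most `m`. The element `y i`
  -- is chosen to satisfy the longest such segment with `m ≤ i` that is satisfiable there, if there
  -- is one; nonprincipality then makes any fixed code eventually at most `i`.
  let Sat : ℕ → ℕ → M → Prop := fun i m b =>
    ∀ φ ∈ p, e φ ≤ m → φ.Realize (Sum.elim (fun a => x a i) fun _ => b)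
  have hdiag : ∀ i k : ℕ, ∃ b, ∀ m ≤ k, (∃ c, Sat i m c) → Sat i m b := by
    intro i k
    induction k with
    | zero =>
      by_cases h : ∃ c, Sat i 0 c
      · obtain ⟨c, hc⟩ := h
        exact ⟨c, fun m hm _ => by rwa [Nat.le_zero.1 hm]⟩
      · exact ⟨Classical.arbitrary M, fun m hm h' => (h (Nat.le_zero.1 hm ▸ h')).elim⟩
    | succ k ih =>
      by_cases h : ∃ c, Sat i (k + 1) c
      · obtain ⟨c, hc⟩ := h
        exact ⟨c, fun m hm _ φ hφ hle => hc φ hφ (hle.trans hm)⟩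
      · obtain ⟨b, hb⟩ := ih
        refine ⟨b, fun m hm h' => hb m ?_ h'⟩
        rcases hm.lt_or_eq with hlt | rfl
        · omega
        · exact (h h').elim
  choose y hy using fun i => hdiag i i
  refine ⟨Quotient.mk _ y, fun φ hφ => (los y φ).2 ?_⟩
  have hfin : {ψ ∈ p | e ψ ≤ e φ}.Finite :=
    ((Set.finite_Iic (e φ)).preimage he.injOn).subset fun ψ hψ => hψ.2
  obtain ⟨c, hc⟩ := hp _ (Set.sep_subset _ _) hfin
  obtain ⟨c, rfl⟩ := Quotient.mk_surjective c
  have h1 : ∀ᶠ i in (hyperfilter ℕ : Filter ℕ), ∀ ψ ∈ {ψ ∈ p | e ψ ≤ e φ},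
      ψ.Realize (Sum.elim (fun a => x a i) fun _ => c i) :=
    (Filter.eventually_all_finite hfin).2 fun ψ hψ => (los c ψ).1 (hc ψ hψ)
  have h2 : ∀ᶠ i in (hyperfilter ℕ : Filter ℕ), e φ ≤ i :=
    Nat.hyperfilter_le_atTop (eventually_ge_atTop (e φ))
  filter_upwards [h1, h2] with i hi hle
  exact hy i (e φ) hle ⟨c i, fun ψ hψ hψφ => hi ψ ⟨hψ, hψφ⟩⟩ φ hφ le_rfl

end Ultrapower

/-! ### Saturation -/

section Saturation

lemma range_sumElim_coe {M : Type*} (A : Set M) (b : M) :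
    Set.range (Sum.elim (fun a : A => (a : M)) fun _ : Unit => b) = insert b A := by
  rw [Set.Sum.elim_range, Subtype.range_coe, Set.range_const, Set.union_comm, Set.insert_eq]

lemma ball_empty {V : Type*} (G : SimpleGraph V) (n : ℕ) : ball G ∅ n = ∅ := by
  induction n with
  | zero => rfl
  | succ n ih => simp [ball, ih]

variable {M : Type*} [Language.graph.Structure M]

/-- Compactness: `n`-strongness weakens as `n` decreases, so finitely many of the conditions follow
from the one with the largest `n`. -/
lemma IsOmegaSaturated.exists_isStrong_insert [M ⊨ Theory.simpleGraph]
    (hM : IsOmegaSaturated Language.graph M) {A Q : Set M} (hA : A.Finite) (hQ : Q ⊆ A)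
    (h : ∀ n, ∃ x, x ∉ A ∧ (simpleGraphOfStructure M).neighborSet x ∩ A = Q ∧
      IsNStrong (simpleGraphOfStructure M) n (insert x A)) :
    ∃ x, x ∉ A ∧ (simpleGraphOfStructure M).neighborSet x ∩ A = Q ∧
      IsStrong (simpleGraphOfStructure M) (insert x A) := by
  have : Finite A := hA
  let φ : ℕ → Language.graph.Formula (A ⊕ Unit) := fun n =>
    neighborsFormula Sum.inl (Subtype.val ⁻¹' Q) (Sum.inr ()) ⊓ isNStrongFormula _ n
  have hφ : ∀ n b, (φ n).Realize (Sum.elim (fun a : A => (a : M)) fun _ => b) ↔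
      (b ∉ A ∧ (simpleGraphOfStructure M).neighborSet b ∩ A = Q) ∧
        IsNStrong (simpleGraphOfStructure M) n (insert b A) := by
    intro n b
    have hcomp : (Sum.elim (fun a : A => (a : M)) fun _ : Unit => b) ∘ Sum.inl = Subtype.val := rfl
    rw [Formula.realize_inf, realize_isNStrongFormula, realize_neighborsFormula, range_sumElim_coe,
      hcomp, Subtype.range_coe, Subtype.image_preimage_coe, Set.inter_eq_right.2 hQ, Sum.elim_inr]
    exact Subtype.val_injective
  obtain ⟨b, hb⟩ := hM A hA (Set.range φ) fun q hq hqfin => by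
    have : Finite q := hqfin
    choose f hf using fun ψ : q => hq ψ.2
    obtain ⟨n, hn⟩ := (Set.finite_range f).bddAbove
    obtain ⟨x, hx, hxQ, hxn⟩ := h n
    refine ⟨x, fun ψ hψ => ?_⟩
    have := (hφ (f ⟨ψ, hψ⟩) x).2 ⟨⟨hx, hxQ⟩, hxn.anti (hn ⟨_, rfl⟩)⟩
    rwa [hf] at this
  have hb' : ∀ n, _ := fun n => (hφ n b).1 (hb _ ⟨n, rfl⟩)
  exact ⟨b, (hb' 0).1.1, (hb' 0).1.2, isStrong_iff_isNStrong.2 fun n => (hb' n).2⟩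

lemma IsOmegaSaturated.hasPendantExtensions [M ⊨ Theory.simpleGraph] [Nonempty M]
    (hG : IsFareyGraph (simpleGraphOfStructure M)) (hM : IsOmegaSaturated Language.graph M) :
    HasPendantExtensions (simpleGraphOfStructure M) := by
  have hpend : ∀ B a, B.Finite → IsStrong (simpleGraphOfStructure M) B → a ∈ B →
      ∃ x, x ∉ B ∧ (simpleGraphOfStructure M).neighborSet x ∩ B = {a} ∧
        IsStrong (simpleGraphOfStructure M) (insert x B) := fun B a hfin hB ha =>
    hM.exists_isStrong_insert hfin (Set.singleton_subset_iff.2 ha)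
      (hG.exists_isNStrong_pendant hB hfin ha)
  intro A Q hfin hA hQ hcard
  rcases Set.encard_le_one_iff_eq.1 hcard with rfl | ⟨a, rfl⟩
  · refine hM.exists_isStrong_insert hfin hQ fun n => ?_
    obtain ⟨x, hx⟩ : ∃ x, x ∉ ball (simpleGraphOfStructure M) A (n + 1) := by
      -- The balls around the empty set are empty, so any vertex is far from it; otherwise the
      -- singleton case already proved produces far vertices.
      rcases A.eq_empty_or_nonempty with rfl | hne
      · rw [ball_empty]
        exact ⟨Classical.arbitrary M, Set.notMem_empty _⟩
      · exact hA.exists_notMem_ball hfin hne hpend _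
    obtain ⟨h1, h2⟩ := neighborSet_inter_of_notMem_ball fun h => hx (ball_mono (by omega) h)
    exact ⟨x, h1, h2, hA.isNStrong_insert_of_notMem_ball hx⟩
  · exact hpend A a hfin hA (hQ rfl)

lemma isFareyGraph [M ⊨ fareyTheory] : IsFareyGraph (simpleGraphOfStructure M) := by
  have h : M ⊨ fareyTheory := inferInstance
  obtain ⟨h1, h2, h3⟩ := model_fareyTheory_iff.1 h
  exact ⟨h1, h2, h3⟩

theorem IsOmegaSaturated.isKSaturated [M ⊨ fareyTheory] [Nonempty M]
    (hM : IsOmegaSaturated Language.graph M) : IsKSaturated (simpleGraphOfStructure M) :=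
  isFareyGraph.isKSaturated (hM.hasPendantExtensions isFareyGraph)

instance countable_symbols_graph : Countable Language.graph.Symbols := by
  have h1 : Countable (Σ n, Language.graph.Functions n) := ⟨fun f => f.2.elim, fun f => f.2.elim⟩
  have h2 : Countable (Σ n, Language.graph.Relations n) := inferInstance
  exact inferInstanceAs (Countable (_ ⊕ _))

theorem IsKSaturated.isOmegaSaturated [M ⊨ fareyTheory] [Nonempty M]
    (hM : IsKSaturated (simpleGraphOfStructure M)) : IsOmegaSaturated Language.graph M := by
  let N := (Filter.hyperfilter ℕ : Filter ℕ).Product fun _ => M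
  have hNT : N ⊨ fareyTheory := by
    have h : M ⊨ fareyTheory := inferInstance
    rw [Theory.model_iff] at h ⊢
    exact fun φ hφ =>
      (Ultraproduct.sentence_realize φ).2 (Filter.Eventually.of_forall fun _ => h φ hφ)
  have hNsat : IsOmegaSaturated Language.graph N := fun A hA p hp => by
    have : Finite A := hA
    exact ultrapower_exists_realize _ p hp
  have hN := hNsat.isKSaturated
  have hGM := isFareyGraph (M := M)
  have hGN := isFareyGraph (M := N)
  let d : M → N := fun m => Quotient.mk _ fun _ => m
  have hd : ∀ {J : Type} (φ : Language.graph.Formula J) (v : J → M),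
      φ.Realize (d ∘ v) ↔ φ.Realize v := fun φ v => realize_ultrapower_const φ v
  intro A hA p hp
  have : Finite A := hA
  -- a realization of the type in `N`
  have helim : ∀ b : M, d ∘ Sum.elim (fun a : A => (a : M)) (fun _ : Unit => b) =
      Sum.elim (fun a : A => d a) fun _ => d b := fun b => by ext (_ | _) <;> rfl
  obtain ⟨b, hb⟩ := ultrapower_exists_realize (fun a : A => d a) p fun q hq hqfin => by
    obtain ⟨b, hb⟩ := hp q hq hqfin
    refine ⟨d b, fun φ hφ => ?_⟩
    rw [← helim]
    exact (realize_ultrapower_const φ _).2 (hb φ hφ)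
  -- a finite strong set containing the parameters
  obtain ⟨C, hAC, hCfin, hC⟩ := hGM.exists_isStrong_superset hA
  have : Finite C := hCfin
  obtain ⟨n, ⟨i⟩⟩ := Finite.exists_equiv_fin C
  let k : Fin n → M := fun m => i.symm m
  have hk : Function.Injective k := Subtype.val_injective.comp i.symm.injective
  have hrange : Set.range k = C := by
    ext z
    exact ⟨by rintro ⟨m, rfl⟩; exact (i.symm m).2, fun hz => ⟨i ⟨z, hz⟩, by simp [k]⟩⟩
  -- The diagonal map is elementary, so it preserves equality, adjacency and every `n`-strongness;
  -- hence it sends `C` to a strong set of `N`.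
  have hdk : Function.Injective (d ∘ k) := fun m m' h => by
    have := (hd (eqFormula m m') k).1 ((realize_eqFormula m m' _).2 h)
    exact hk ((realize_eqFormula m m' k).1 this)
  let H : SimpleGraph (Fin n) := (simpleGraphOfStructure M).comap k
  let e : H ↪g simpleGraphOfStructure M := ⟨⟨k, hk⟩, Iff.rfl⟩
  let e' : H ↪g simpleGraphOfStructure N := ⟨⟨d ∘ k, hdk⟩, fun {m m'} => by
    have := hd (adjFormula m m') k
    rw [realize_adjFormula, realize_adjFormula] at this
    exact this⟩
  have he : IsStrong (simpleGraphOfStructure M) (Set.range e) := by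
    have : Set.range e = C := hrange
    rwa [this]
  have he' : IsStrong (simpleGraphOfStructure N) (Set.range e') := by
    rw [isStrong_iff_isNStrong] at he ⊢
    intro m
    have := hd (isNStrongFormula (Fin n) m) k
    rw [realize_isNStrongFormula, realize_isNStrongFormula] at this
    exact this.2 (he m)
  have hiso : StronglyIsomorphic (simpleGraphOfStructure N) (simpleGraphOfStructure M)
      (fun a : A => d a) fun a : A => (a : M) := by
    have hlift : ∀ a : A, ∃ m, k m = a := fun a => by
      have : (a : M) ∈ Set.range k := hrange ▸ hAC a.2
      exact this
    choose t ht using hlift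
    exact ⟨Fin n, H, e', e, t, inferInstance, he', he, fun a => congrArg d (ht a).symm,
      fun a => (ht a).symm⟩
  -- One forth step from `N` to `M` gives `c` the same type over the parameters as `b`.
  obtain ⟨c, hc⟩ := hiso.extend hGN hM b
  exact ⟨c, fun φ hφ => (hc.realize_formula_iff hGN hGM hN hM φ).1 (hb φ hφ)⟩

end Saturation

end FareyModel

theorem mainTheorem6 (M : Type*) [FirstOrder.Language.graph.Structure M] [Nonempty M]
    [FirstOrder.Language.Theory.Model M FareyModel.fareyTheory] :
    FareyModel.IsKSaturated (FirstOrder.Language.simpleGraphOfStructure M) ↔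
      FareyModel.IsOmegaSaturated FirstOrder.Language.graph M :=
  ⟨FareyModel.IsKSaturated.isOmegaSaturated, FareyModel.IsOmegaSaturated.isKSaturated⟩
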